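/- Proposition 1.12. Let $n\in\mathbb N$. Write $\langle\xi\rangle=(1+|\xi|^2)^{1/2}$ and $\mathcal F f(\xi)=(2\pi)^{-n/2}\int_{\mathbb R^n} f(x)e^{-ix\cdot\xi}\,dx$, extended to the space $\mathcal S'(\mathbb R^n)$ of tempered distributions. Let $\phi\in\mathcal S(\mathbb R^n)\setminus\{0\}$ be a window and, for $f\in\mathcal S'(\mathbb R^n)$, let $$V_\phi f(x,\xi)=(2\pi)^{-n/2}\int_{\mathbb R^n} f(t)\,\overline{\phi(t-x)}\,e^{-it\cdot\xi}\,dt\qquad(x,\xi\in\mathbb R^n),$$ where the integral denotes the pairing of $f$ with the Schwartz function $t\mapsto\overline{\phi(t-x)}e^{-it\cdot\xi}$. Let $\rho\in\mathcal S(\mathbb R^n)$ have values in $[0,1]$, be supported in the cube $[-1,1]^n$ and satisfy $\rho(\xi)=1$ for $|\xi|\le\frac12$ and $\sum_{k\in\mathbb Z^n}\rho(\xi-k)>0$ for every $\xi\in\mathbb R^n$. Put $$\sigma_k(\xi)=\rho(\xi-k)\Big(\sum_{l\in\mathbb Z^n}\rho(\xi-l)\Big)^{-1},\qquad \Box_k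 f=\mathcal F^{-1}(\sigma_k\,\mathcal F f)\qquad(k\in\mathbb Z^n).$$ For $s\in\mathbb R$, $p,q\in[1,\infty]$ and $f\in\mathcal S'(\mathbb R^n)$ define, with values in $[0,\infty]$, $$\|f\|_{\mathring M^{p,q}_s}=\Big(\int_{\mathbb R^n}\Big(\int_{\mathbb R^n}|V_\phi f(x,\xi)\langle\xi\rangle^s|^p\,dx\Big)^{q/p}d\xi\Big)^{1/q},\qquad \|f\|_{M^{p,q}_s}=\Big(\sum_{k\in\mathbb Z^n}\langle k\rangle^{sq}\,\|\Box_k f\|_{L^p}^q\Big)^{1/q},$$ with the usual modifications if $p=\infty$ or $q=\infty$; here $\|\Box_kf\|_{L^p}=\infty$ if the distribution $\Box_kf$ is not given by an $L^p$ function. Then for every $s\in\mathbb R$ there are constants $C_1,C_2>0$, depending only on $n$, $s$, the window $\phi$ and the decomposition function $\rho$, such that for all $p,q\in[1,\infty]$ and all $f\in\mathcal S'(\mathbb R^n)$ $$C_1\,\|f\|_{\mathring M^{p,q}_s}\le\|f\|_{M^{p,q}_s}\le C_2\,\|f\|_{\mathring M^{p,q}_s}.$$ In particular, one of the two norms is finite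 if and only if the other one is. -/

import Mathlib

open MeasureTheory
open scoped SchwartzMap FourierTransform ENNReal NNReal ComplexConjugate

noncomputable section

namespace ModulationSpace

/-- The Japanese bracket power `⟨ξ⟩ ^ s = (1 + |ξ|²) ^ (s / 2)`, with the Euclidean norm. -/
def bracket {n : ℕ} (s : ℝ) (ξ : EuclideanSpace ℝ (Fin n)) : ℝ :=
  (1 + ‖ξ‖ ^ 2) ^ (s / 2)

/-- The lattice point `k ∈ ℤⁿ`, as a vector of `ℝⁿ`. -/
def latticePoint {n : ℕ} (k : Fin n → ℤ) : EuclideanSpace ℝ (Fin n) :=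
  WithLp.toLp 2 (fun i => (k i : ℝ))

/-! ### The Fourier transform in the normalization `(2π)^{-n/2} ∫ f(x) e^{-i x·ξ} dx` -/

/-- The dilation `x ↦ (2π)⁻¹ x` of `ℝⁿ`. -/
def dilation (n : ℕ) : EuclideanSpace ℝ (Fin n) ≃L[ℝ] EuclideanSpace ℝ (Fin n) :=
  ContinuousLinearEquiv.smulLeft (Units.mk0 ((2 * Real.pi)⁻¹ : ℝ) (by positivity))

/-- The normalizing factor `(2π)^{-n/2}`. -/
def normFactor (n : ℕ) : ℂ := (((2 * Real.pi) ^ (-(n : ℝ) / 2) : ℝ) : ℂ)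

/-- `𝓕 u (ξ) = (2π)^{-n/2} ∫ u(x) e^{-i x·ξ} dx` on Schwartz functions. Mathlib's transform
uses the kernel `e^{-2π i x·ξ}` and no factor, hence the dilation; see `fourierS_apply`. -/
def fourierS (n : ℕ) :
    𝓢(EuclideanSpace ℝ (Fin n), ℂ) →L[ℂ] 𝓢(EuclideanSpace ℝ (Fin n), ℂ) :=
  normFactor n • (SchwartzMap.compCLMOfContinuousLinearEquiv ℂ (dilation n)).comp
    (FourierTransform.fourierCLM ℂ 𝓢(EuclideanSpace ℝ (Fin n), ℂ))

/-- `𝓕⁻¹ u (x) = (2π)^{-n/2} ∫ u(ξ) e^{i x·ξ} dξ` on Schwartz functions;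
see `fourierInvS_apply`. -/
def fourierInvS (n : ℕ) :
    𝓢(EuclideanSpace ℝ (Fin n), ℂ) →L[ℂ] 𝓢(EuclideanSpace ℝ (Fin n), ℂ) :=
  normFactor n • (SchwartzMap.compCLMOfContinuousLinearEquiv ℂ (dilation n)).comp
    (FourierTransform.fourierInvCLM ℂ 𝓢(EuclideanSpace ℝ (Fin n), ℂ))

theorem fourierS_apply {n : ℕ} (u : 𝓢(EuclideanSpace ℝ (Fin n), ℂ))
    (ξ : EuclideanSpace ℝ (Fin n)) :
    fourierS n u ξ = normFactor n * ∫ x, u x * Complex.exp (-Complex.I * (inner ℝ x ξ : ℝ)) := by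
  have h : fourierS n u ξ = normFactor n * (𝓕 u) ((2 * Real.pi)⁻¹ • ξ) := rfl
  rw [h, SchwartzMap.fourier_coe, Real.fourier_eq']
  congr 2
  ext x
  rw [smul_eq_mul, mul_comm, real_inner_smul_right]
  congr 2
  have : (Real.pi : ℂ) ≠ 0 := by exact_mod_cast Real.pi_ne_zero
  push_cast
  field_simp

theorem fourierInvS_apply {n : ℕ} (u : 𝓢(EuclideanSpace ℝ (Fin n), ℂ))
    (x : EuclideanSpace ℝ (Fin n)) :
    fourierInvS n u x = normFactor n * ∫ ξ, u ξ * Complex.exp (Complex.I * (inner ℝ x ξ : ℝ)) := by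
  have h : fourierInvS n u x = normFactor n * (𝓕⁻ u) ((2 * Real.pi)⁻¹ • x) := rfl
  rw [h, SchwartzMap.fourierInv_coe, Real.fourierInv_eq']
  congr 2
  ext ξ
  rw [smul_eq_mul, mul_comm, real_inner_smul_right, real_inner_comm]
  congr 2
  have : (Real.pi : ℂ) ≠ 0 := by exact_mod_cast Real.pi_ne_zero
  push_cast
  field_simp

/-- The Fourier transform of a tempered distribution: `(𝓕 f)(u) = f(𝓕 u)`. -/
def fourierD (n : ℕ) :
    𝓢'(EuclideanSpace ℝ (Fin n), ℂ) →L[ℂ] 𝓢'(EuclideanSpace ℝ (Fin n), ℂ) :=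
  PointwiseConvergenceCLM.precomp ℂ (fourierS n)

/-- The inverse Fourier transform of a tempered distribution: `(𝓕⁻¹ f)(u) = f(𝓕⁻¹ u)`. -/
def fourierInvD (n : ℕ) :
    𝓢'(EuclideanSpace ℝ (Fin n), ℂ) →L[ℂ] 𝓢'(EuclideanSpace ℝ (Fin n), ℂ) :=
  PointwiseConvergenceCLM.precomp ℂ (fourierInvS n)

/-! ### The short-time Fourier transform and its modulation norm -/

/-- The character `t ↦ e^{-i t·ξ}` on `ℝⁿ`. -/
def character {n : ℕ} (ξ : EuclideanSpace ℝ (Fin n)) (t : EuclideanSpace ℝ (Fin n)) : ℂ :=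
  Complex.exp (-Complex.I * (inner ℝ t ξ : ℝ))

theorem character_hasTemperateGrowth {n : ℕ} (ξ : EuclideanSpace ℝ (Fin n)) :
    (character ξ).HasTemperateGrowth := by
  have hd : ∀ m : ℕ, iteratedDeriv m (fun t : ℝ => Complex.exp (-Complex.I * (t : ℂ))) =
      fun t : ℝ => (-Complex.I) ^ m * Complex.exp (-Complex.I * (t : ℂ)) := by
    intro m
    induction m with
    | zero => simp
    | succ m ih =>
      rw [iteratedDeriv_succ, ih]
      ext t
      have h : HasDerivAt (fun t : ℝ => -Complex.I * (t : ℂ)) (-Complex.I) t := by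
        simpa using (Complex.ofRealCLM.hasDerivAt (x := t)).const_mul (-Complex.I)
      rw [(h.cexp.const_mul ((-Complex.I) ^ m)).deriv]
      ring
  have he : (fun t : ℝ => Complex.exp (-Complex.I * (t : ℂ))).HasTemperateGrowth := by
    refine ⟨(contDiff_const.mul Complex.ofRealCLM.contDiff).cexp, fun m => ⟨0, 1, fun t => ?_⟩⟩
    rw [norm_iteratedFDeriv_eq_norm_iteratedDeriv, hd m]
    have : ‖Complex.exp (-Complex.I * (t : ℂ))‖ = 1 := by
      rw [Complex.norm_exp]
      simp
    simpa using this.le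
  exact he.comp (Function.hasTemperateGrowth_inner_left ξ)

/-- The Schwartz function `t ↦ conj (φ (t - x)) e^{-i t·ξ}`, the complex conjugate of the
time-frequency shift `M_ξ T_x φ`; see `timeFreqShift_apply`. -/
def timeFreqShift {n : ℕ} (φ : 𝓢(EuclideanSpace ℝ (Fin n), ℂ))
    (x ξ : EuclideanSpace ℝ (Fin n)) : 𝓢(EuclideanSpace ℝ (Fin n), ℂ) :=
  SchwartzMap.smulLeftCLM ℂ (character ξ)
    (SchwartzMap.compSubConstCLM ℝ x
      (SchwartzMap.postcompCLM (𝕜 := ℝ) (Complex.conjCLE : ℂ →L[ℝ] ℂ) φ))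

theorem timeFreqShift_apply {n : ℕ} (φ : 𝓢(EuclideanSpace ℝ (Fin n), ℂ))
    (x ξ t : EuclideanSpace ℝ (Fin n)) :
    timeFreqShift φ x ξ t = conj (φ (t - x)) * Complex.exp (-Complex.I * (inner ℝ t ξ : ℝ)) := by
  rw [timeFreqShift, SchwartzMap.smulLeftCLM_apply_apply (character_hasTemperateGrowth ξ),
    smul_eq_mul, mul_comm]
  rfl

/-- The short-time Fourier transform of a tempered distribution `f` with window `φ`,
`V_φ f (x, ξ) = (2π)^{-n/2} ∫ f(t) conj (φ(t - x)) e^{-i t·ξ} dt`, the integral being the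
pairing of `f` with a Schwartz function. -/
def stft {n : ℕ} (φ : 𝓢(EuclideanSpace ℝ (Fin n), ℂ)) (f : 𝓢'(EuclideanSpace ℝ (Fin n), ℂ))
    (x ξ : EuclideanSpace ℝ (Fin n)) : ℂ :=
  normFactor n * f (timeFreqShift φ x ξ)

/-- The norm `‖f‖ = ( ∫ ( ∫ |V_φ f(x,ξ) ⟨ξ⟩^s|^p dx )^{q/p} dξ )^{1/q}`, with `L^∞` norms when
`p = ∞` or `q = ∞`; it has the value `∞` exactly if `f` is not in the space. -/
def stftNorm {n : ℕ} (φ : 𝓢(EuclideanSpace ℝ (Fin n), ℂ)) (s : ℝ) (p q : ℝ≥0∞)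
    (f : 𝓢'(EuclideanSpace ℝ (Fin n), ℂ)) : ℝ≥0∞ :=
  eLpNorm (fun ξ : EuclideanSpace ℝ (Fin n) =>
    eLpNorm (fun x : EuclideanSpace ℝ (Fin n) => stft φ f x ξ * (bracket s ξ : ℂ)) p volume)
    q volume

/-! ### The frequency-uniform decomposition and its modulation norm -/

/-- The functions `ρ` from which a frequency-uniform decomposition is built: Schwartz functions
with values in `[0,1]`, supported in the cube `[-1,1]ⁿ`, equal to `1` on the ball `|ξ| ≤ 1/2`,
whose integer translates have no common zero. -/
structure IsDecompositionFunction {n : ℕ} (ρ : 𝓢(EuclideanSpace ℝ (Fin n), ℝ)) : Prop where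
  nonneg : ∀ ξ, 0 ≤ ρ ξ
  le_one : ∀ ξ, ρ ξ ≤ 1
  support_subset : ∀ ξ, ρ ξ ≠ 0 → ∀ i, -1 ≤ ξ i ∧ ξ i ≤ 1
  eq_one : ∀ ξ, ‖ξ‖ ≤ 1 / 2 → ρ ξ = 1
  cover : ∀ ξ, ∃ k : Fin n → ℤ, ρ (ξ - latticePoint k) ≠ 0

/-- `σ_k(ξ) = ρ(ξ - k) / ∑_{l ∈ ℤⁿ} ρ(ξ - l)`; at each `ξ` the sum has finitely many nonzero
terms. -/
def sigma {n : ℕ} (ρ : 𝓢(EuclideanSpace ℝ (Fin n), ℝ)) (k : Fin n → ℤ)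
    (ξ : EuclideanSpace ℝ (Fin n)) : ℝ :=
  ρ (ξ - latticePoint k) * (∑' l : Fin n → ℤ, ρ (ξ - latticePoint l))⁻¹

theorem sigma_hasTemperateGrowth {n : ℕ} {ρ : 𝓢(EuclideanSpace ℝ (Fin n), ℝ)}
    (hρ : IsDecompositionFunction ρ) (k : Fin n → ℤ) :
    (fun ξ => (sigma ρ k ξ : ℂ)).HasTemperateGrowth := by
  have hbd : ∀ (l : Fin n → ℤ) (ξ : EuclideanSpace ℝ (Fin n)), ρ (ξ - latticePoint l) ≠ 0 →
      ∀ i, |ξ i - l i| ≤ 1 := fun l ξ h i => abs_le.2 (by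
    simpa [latticePoint] using hρ.support_subset _ h i)
  have hfin : ∀ R : ℝ, {l : Fin n → ℤ | ∀ i, |(l i : ℝ)| ≤ R}.Finite := fun R => by
    refine (Set.Finite.pi' (fun _ : Fin n => Set.finite_Icc (-⌈R⌉) ⌈R⌉)).subset fun l hl i => ?_
    have := abs_le.1 (hl i)
    have h2 := Int.le_ceil R
    constructor
    · exact_mod_cast (by push_cast; linarith : ((-⌈R⌉ : ℤ) : ℝ) ≤ l i)
    · exact_mod_cast (by linarith : (l i : ℝ) ≤ ⌈R⌉)
  have hcoord : ∀ (ξ : EuclideanSpace ℝ (Fin n)) (i : Fin n), |ξ i| ≤ ‖ξ‖ := fun ξ i => by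
    simpa using PiLp.norm_apply_le ξ i
  have hlf : LocallyFinite fun l : Fin n → ℤ =>
      Function.support fun ξ : EuclideanSpace ℝ (Fin n) => ρ (ξ - latticePoint l) := by
    intro ξ
    refine ⟨Metric.ball ξ 1, Metric.ball_mem_nhds ξ one_pos,
      (hfin (‖ξ‖ + 2)).subset ?_⟩
    rintro l ⟨η, hη, hηξ⟩ i
    have h1 := hbd l η hη i
    have h2 := hcoord η i
    have h3 : ‖η‖ ≤ ‖ξ‖ + 1 := by
      have := norm_le_norm_add_norm_sub' η ξ
      have h4 : ‖η - ξ‖ < 1 := by simpa [dist_eq_norm] using hηξ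
      linarith
    have h5 : |(l i : ℝ)| ≤ |η i| + |η i - l i| := by
      have := abs_sub (η i) (η i - l i)
      simpa using this
    linarith
  have hsm : ∀ l : Fin n → ℤ,
      ContDiff ℝ (⊤ : ℕ∞) fun ξ : EuclideanSpace ℝ (Fin n) => ρ (ξ - latticePoint l) :=
    fun l => (ρ.smooth _).comp (contDiff_id.sub contDiff_const)
  have hsum : ∀ ξ, ∑' l : Fin n → ℤ, ρ (ξ - latticePoint l) =
      ∑ᶠ l : Fin n → ℤ, ρ (ξ - latticePoint l) := fun ξ =>
    tsum_eq_finsum (hlf.point_finite ξ)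
  have hden : ContDiff ℝ (⊤ : ℕ∞) fun ξ : EuclideanSpace ℝ (Fin n) =>
      ∑' l : Fin n → ℤ, ρ (ξ - latticePoint l) := by
    simp_rw [hsum]
    exact contMDiff_iff_contDiff.1 (contMDiff_finsum (fun l => (hsm l).contMDiff) hlf)
  have hpos : ∀ ξ, ∑' l : Fin n → ℤ, ρ (ξ - latticePoint l) ≠ 0 := fun ξ => by
    obtain ⟨m, hm⟩ := hρ.cover ξ
    have hs : Summable fun l : Fin n → ℤ => ρ (ξ - latticePoint l) :=
      summable_of_hasFiniteSupport (hlf.point_finite ξ)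
    exact (hs.tsum_pos (fun l => hρ.nonneg _) m ((hρ.nonneg _).lt_of_ne' hm)).ne'
  refine HasCompactSupport.hasTemperateGrowth ?_ ?_
  · refine HasCompactSupport.intro (isCompact_closedBall (0 : EuclideanSpace ℝ (Fin n))
      (‖latticePoint k‖ + √n)) fun ξ hξ => ?_
    by_contra h
    have h0 : ρ (ξ - latticePoint k) ≠ 0 := by
      intro h0
      simp [sigma, h0] at h
    have h1 : ‖ξ - latticePoint k‖ ≤ √n := by
      rw [EuclideanSpace.norm_eq]
      refine Real.sqrt_le_sqrt ?_
      calc ∑ i, ‖(ξ - latticePoint k) i‖ ^ 2 ≤ ∑ _i : Fin n, (1 : ℝ) :=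
            Finset.sum_le_sum fun i _ => by
              have := abs_le.2 (hρ.support_subset _ h0 i)
              rw [Real.norm_eq_abs]
              exact pow_le_one₀ (abs_nonneg _) this
        _ = n := by simp
    have h2 := norm_le_norm_add_norm_sub' ξ (latticePoint k)
    exact hξ (by simpa using h2.trans (by linarith))
  · exact Complex.ofRealCLM.contDiff.comp ((hsm k).mul (hden.inv hpos))

/-- The uniform decomposition operator `□_k f = 𝓕⁻¹ (σ_k 𝓕 f)` on tempered distributions. -/
def box {n : ℕ} (ρ : 𝓢(EuclideanSpace ℝ (Fin n), ℝ)) (k : Fin n → ℤ)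
    (f : 𝓢'(EuclideanSpace ℝ (Fin n), ℂ)) : 𝓢'(EuclideanSpace ℝ (Fin n), ℂ) :=
  fourierInvD n (TemperedDistribution.smulLeftCLM ℂ (fun ξ => (sigma ρ k ξ : ℂ)) (fourierD n f))

/-- The function `g` represents the tempered distribution `T`. -/
def Represents {n : ℕ} (g : EuclideanSpace ℝ (Fin n) → ℂ)
    (T : 𝓢'(EuclideanSpace ℝ (Fin n), ℂ)) : Prop :=
  ∀ u : 𝓢(EuclideanSpace ℝ (Fin n), ℂ), T u = ∫ x, g x * u x

/-- The `L^p` norm of a tempered distribution: the `L^p` norm of the `L^p` function that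
represents it (unique up to null sets), and `∞` if there is none. -/
def lpNorm {n : ℕ} (p : ℝ≥0∞) (T : 𝓢'(EuclideanSpace ℝ (Fin n), ℂ)) : ℝ≥0∞ :=
  ⨅ (g : EuclideanSpace ℝ (Fin n) → ℂ) (_ : MemLp g p volume) (_ : Represents g T),
    eLpNorm g p volume

/-- The norm `‖f‖ = ( ∑_{k ∈ ℤⁿ} ⟨k⟩^{sq} ‖□_k f‖_{L^p}^q )^{1/q}`, with a supremum when
`q = ∞`; it has the value `∞` exactly if `f` is not in the space. -/
def decompositionNorm {n : ℕ} (ρ : 𝓢(EuclideanSpace ℝ (Fin n), ℝ)) (s : ℝ) (p q : ℝ≥0∞)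
    (f : 𝓢'(EuclideanSpace ℝ (Fin n), ℂ)) : ℝ≥0∞ :=
  if q = ∞ then
    ⨆ k : Fin n → ℤ, ENNReal.ofReal (bracket s (latticePoint k)) * lpNorm p (box ρ k f)
  else
    (∑' k : Fin n → ℤ,
      (ENNReal.ofReal (bracket s (latticePoint k)) * lpNorm p (box ρ k f)) ^ q.toReal)
        ^ (1 / q.toReal)

end ModulationSpace

end

/-! Both norms are weighted mixed norms of one kind of coefficient. For `U = 𝓕 f` and a Schwartz
function `d`, let `coeff U d ξ t = U (e^{i t·} d(· - ξ))`. Up to the factor `(2π)^{-n/2}` and a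
unimodular factor, `V_φ f(t, ξ)` is this coefficient for `d = conj (𝓕 φ)`, with `ξ` ranging over
`ℝⁿ` under Lebesgue measure (`stftNorm_eq`). Up to `(2π)^{-n/2}`, `□_k f(t)` is the coefficient for
`d = σ₀` at `ξ = k`, with `k` ranging over the lattice under counting measure
(`decompositionNorm_eq`). Hence both inequalities are instances of one comparison,
`exists_eLpNorm_eLpNorm_coeff_le`.

For the comparison, suppose that the translates of `b d` along a family of points `ι y` integrate to
a nonzero constant. Inserting this resolution of the identity writes the coefficient for `a` at `x`
as an integral over `y` of `U` applied to `e^{i t·} a(· - x) b(· - ι y) d(· - ι y)`. Multiplication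
by `a(· - x) b(· - ι y)` acts on the coefficient for `d` at `ι y` as a convolution in `t`. Its
kernel is bounded by `C (1 + |x - ι y|)^{-M} (1 + |z|)^{-(n+1)}` for any prescribed `M`
(`exists_norm_fourierS_mulS_le`). Minkowski's inequality handles the `L^p` norm in `t`, Peetre's
inequality absorbs the weight, and Schur's test handles the `L^q` norm. Only `L^1` bounds of kernels
enter, so the constants do not depend on `p` and `q`.

The resolutions used are `∑_k σ_k = 1`, with `b` a cutoff equal to `1` on the support of `σ₀`, and
`∫ |𝓕 φ(η - ξ)|² dξ = ‖𝓕 φ‖₂² ≠ 0`. Moving `U` inside an integral of Schwartz functions is justified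
by `integrable_and_eq_integral`, which reduces it to Bochner integration in a Banach space. -/

noncomputable section

namespace ModulationSpace

/-! ### Integrals of families of Schwartz functions -/

section Exchange

variable {E : Type*} [NormedAddCommGroup E] [NormedSpace ℝ E]

/-- The bundle of the weighted derivatives `‖x‖ ^ k • D ^ l u (x)`, `(k, l) ∈ s`, of a Schwartz
function, as a bounded family. -/
def weightedDerivs (s : Finset (ℕ × ℕ)) :
    𝓢(E, ℂ) →L[ℂ] lp (fun i : s × E => E [×i.1.1.2]→L[ℝ] ℂ) ∞ :=
  SchwartzMap.mkCLMtoNormedSpace (σ := RingHom.id ℂ)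
    (fun u => ⟨fun i => ‖i.2‖ ^ i.1.1.1 • iteratedFDeriv ℝ i.1.1.2 u i.2, by
      refine memℓp_infty ⟨∑ m ∈ s, SchwartzMap.seminorm ℂ m.1 m.2 u, ?_⟩
      rintro _ ⟨⟨m, x⟩, rfl⟩
      refine le_trans ?_ (Finset.single_le_sum (f := fun m : ℕ × ℕ =>
        SchwartzMap.seminorm ℂ m.1 m.2 u) (fun _ _ => apply_nonneg _ _) m.2)
      simpa [norm_smul] using SchwartzMap.le_seminorm ℂ m.1.1 m.1.2 u x⟩)
    (fun u v => by
      ext1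
      funext i
      simp only [lp.coeFn_add, Pi.add_apply]
      rw [← smul_add]
      congr 1
      exact iteratedFDeriv_add_apply ((u.smooth _).contDiffAt) ((v.smooth _).contDiffAt))
    (fun a u => by
      ext1
      funext i
      simp only [lp.coeFn_smul, Pi.smul_apply, RingHom.id_apply]
      rw [smul_comm]
      congr 1
      exact iteratedFDeriv_const_smul_apply (u.smooth _).contDiffAt)
    ⟨s, 1, zero_le_one, fun u => by
      refine lp.norm_le_of_forall_le (mul_nonneg zero_le_one (apply_nonneg _ _)) ?_
      rintro ⟨m, x⟩
      rw [one_mul]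
      refine le_trans ?_ (Seminorm.le_finset_sup_apply (p := schwartzSeminormFamily ℂ E ℂ) m.2)
      simpa [norm_smul, schwartzSeminormFamily] using SchwartzMap.le_seminorm ℂ m.1.1 m.1.2 u x⟩

theorem weightedDerivs_apply (s : Finset (ℕ × ℕ)) (u : 𝓢(E, ℂ)) (i : s × E) :
    weightedDerivs s u i = ‖i.2‖ ^ i.1.1.1 • iteratedFDeriv ℝ i.1.1.2 u i.2 := rfl

theorem seminorm_le_norm_weightedDerivs {s : Finset (ℕ × ℕ)} {m : ℕ × ℕ} (hm : m ∈ s)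
    (u : 𝓢(E, ℂ)) : SchwartzMap.seminorm ℂ m.1 m.2 u ≤ ‖weightedDerivs s u‖ := by
  refine SchwartzMap.seminorm_le_bound ℂ _ _ _ (norm_nonneg _) fun x => ?_
  have := lp.norm_apply_le_norm ENNReal.top_ne_zero (weightedDerivs s u) (⟨m, hm⟩, x)
  simpa [weightedDerivs_apply, norm_smul] using this

theorem norm_weightedDerivs_le (s : Finset (ℕ × ℕ)) (u : 𝓢(E, ℂ)) :
    ‖weightedDerivs s u‖ ≤ ∑ m ∈ s, SchwartzMap.seminorm ℂ m.1 m.2 u := by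
  refine lp.norm_le_of_forall_le (Finset.sum_nonneg fun _ _ => apply_nonneg _ _) ?_
  rintro ⟨m, x⟩
  refine le_trans ?_ (Finset.single_le_sum (f := fun m : ℕ × ℕ =>
    SchwartzMap.seminorm ℂ m.1 m.2 u) (fun _ _ => apply_nonneg _ _) m.2)
  simpa [weightedDerivs_apply, norm_smul] using SchwartzMap.le_seminorm ℂ m.1.1 m.1.2 u x

/-- A continuous functional on the Schwartz space factors through finitely many weighted
derivatives. -/
theorem exists_factor_weightedDerivs (U : 𝓢(E, ℂ) →L[ℂ] ℂ) :
    ∃ (s : Finset (ℕ × ℕ)) (Λ : StrongDual ℂ (lp (fun i : s × E => E [×i.1.1.2]→L[ℝ] ℂ) ∞)),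
      ∀ u, U u = Λ (weightedDerivs s u) := by
  obtain ⟨s₀, C, -, hC⟩ := Seminorm.bound_of_continuous (schwartz_withSeminorms ℂ E ℂ)
    ((normSeminorm ℂ ℂ).comp U.toLinearMap) (U.continuous.norm)
  -- The index `(0, 0)` is added so that the map to weighted derivatives controls the sup norm and
  -- is therefore injective.
  set s := insert (0, 0) s₀ with hs
  have hbound : ∀ u, ‖U u‖ ≤ C * ‖weightedDerivs s u‖ := fun u => by
    refine (hC u).trans ?_
    rw [smul_apply]
    refine mul_le_mul_of_nonneg_left ?_ C.2
    exact Seminorm.finset_sup_apply_le (norm_nonneg _) fun m hm =>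
      seminorm_le_norm_weightedDerivs (Finset.mem_insert_of_mem hm) u
  have hinj : Function.Injective (weightedDerivs (E := E) s).toLinearMap := by
    refine (injective_iff_map_eq_zero _).2 fun u hu => ?_
    ext x
    have h1 := seminorm_le_norm_weightedDerivs (Finset.mem_insert_self (0, 0) s₀) u
    have h2 : ‖weightedDerivs s u‖ = 0 := norm_eq_zero.2 hu
    have h3 := SchwartzMap.norm_le_seminorm ℂ u x
    rw [← hs, h2] at h1
    exact norm_le_zero_iff.1 (h3.trans h1)
  let e := LinearEquiv.ofInjective (weightedDerivs (E := E) s).toLinearMap hinj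
  have he : ∀ u, ‖e u‖ = ‖weightedDerivs s u‖ := fun _ => rfl
  -- By injectivity `U` descends to the range of `weightedDerivs s`, where it is bounded by `C`;
  -- Hahn–Banach extends it to the whole Banach space.
  let Λ₀ : StrongDual ℂ (LinearMap.range (weightedDerivs (E := E) s).toLinearMap) :=
    (U.toLinearMap ∘ₗ e.symm.toLinearMap).mkContinuous C fun y => by
      have := hbound (e.symm y)
      rw [← he, e.apply_symm_apply] at this
      exact this
  obtain ⟨Λ, hΛ, -⟩ := exists_extension_norm_eq _ Λ₀
  refine ⟨s, Λ, fun u => ?_⟩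
  have h := hΛ (e u)
  have h2 : Λ₀ (e u) = U (e.symm (e u)) := rfl
  rw [h2, e.symm_apply_apply] at h
  exact h.symm

variable {Y : Type*} [TopologicalSpace Y]

theorem continuous_iteratedFDeriv_apply {w : Y → 𝓢(E, ℂ)} (hw : Continuous w) (l : ℕ) (x : E) :
    Continuous fun y => iteratedFDeriv ℝ l (w y) x := by
  have h := (lp.evalCLM ℂ (fun i : ({(0, l)} : Finset (ℕ × ℕ)) × E => E [×i.1.1.2]→L[ℝ] ℂ) ∞
    (⟨(0, l), Finset.mem_singleton_self _⟩, x)).continuous.comp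
      ((weightedDerivs {(0, l)}).continuous.comp hw)
  refine h.congr fun y => ?_
  change ‖x‖ ^ 0 • iteratedFDeriv ℝ l (w y) x = _
  rw [pow_zero, one_smul]

variable [SecondCountableTopology Y] [MeasurableSpace Y] [OpensMeasurableSpace Y] {μ : Measure Y}

theorem integrable_iteratedFDeriv_apply {w : Y → 𝓢(E, ℂ)} (hw : Continuous w)
    (hint : ∀ k l, Integrable (fun y => SchwartzMap.seminorm ℂ k l (w y)) μ) (l : ℕ) (x : E) :
    Integrable (fun y => iteratedFDeriv ℝ l (w y) x) μ :=
  (hint 0 l).mono' (continuous_iteratedFDeriv_apply hw l x).aestronglyMeasurable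
    (.of_forall fun _ => SchwartzMap.norm_iteratedFDeriv_le_seminorm ℂ _ l x)

/-- Induction on the order, differentiating under the integral sign. The seminorm `(0, l + 1)` of `w
y` dominates the next derivative uniformly in the point, so no smoothness of `W` has to be assumed.
-/
theorem iteratedFDeriv_eq_integral {w : Y → 𝓢(E, ℂ)} (hw : Continuous w)
    (hint : ∀ k l, Integrable (fun y => SchwartzMap.seminorm ℂ k l (w y)) μ)
    {W : E → ℂ} (hW : ∀ x, W x = ∫ y, w y x ∂μ) (l : ℕ) (x : E) :
    iteratedFDeriv ℝ l W x = ∫ y, iteratedFDeriv ℝ l (w y) x ∂μ := by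
  induction l generalizing x with
  | zero =>
    have h : ∀ g : E → ℂ, iteratedFDeriv ℝ 0 g x =
      (continuousMultilinearCurryFin0 ℝ E ℂ).symm (g x) := fun g => rfl
    simp_rw [h, hW]
    exact ((continuousMultilinearCurryFin0 ℝ E ℂ).symm.toContinuousLinearEquiv.integral_comp_comm
      (fun y => w y x)).symm
  | succ l ih =>
    have h1 : ∀ g : E → ℂ, iteratedFDeriv ℝ (l + 1) g x =
        (continuousMultilinearCurryLeftEquiv ℝ (fun _ : Fin (l + 1) => E) ℂ).symm
          (fderiv ℝ (iteratedFDeriv ℝ l g) x) := fun g => by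
      rw [iteratedFDeriv_succ_eq_comp_left]
      rfl
    have h2 : HasFDerivAt (fun x => ∫ y, iteratedFDeriv ℝ l (w y) x ∂μ)
        (∫ y, fderiv ℝ (iteratedFDeriv ℝ l (w y)) x ∂μ) x := by
      refine hasFDerivAt_integral_of_dominated_of_fderiv_le (s := Set.univ)
        (F' := fun x y => fderiv ℝ (iteratedFDeriv ℝ l (w y)) x)
        (bound := fun y => SchwartzMap.seminorm ℂ 0 (l + 1) (w y)) Filter.univ_mem
        (.of_forall fun z => (continuous_iteratedFDeriv_apply hw l z).aestronglyMeasurable)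
        (integrable_iteratedFDeriv_apply hw hint l x) ?_ (.of_forall fun y z _ => ?_)
        (hint 0 (l + 1)) (.of_forall fun y z _ => ?_)
      · refine Continuous.aestronglyMeasurable ?_
        simp_rw [fderiv_iteratedFDeriv]
        exact (LinearIsometryEquiv.continuous _).comp (continuous_iteratedFDeriv_apply hw (l + 1) x)
      · rw [norm_fderiv_iteratedFDeriv]
        exact SchwartzMap.norm_iteratedFDeriv_le_seminorm ℂ _ (l + 1) z
      · have : ContDiff ℝ 1 (iteratedFDeriv ℝ l (w y)) :=
          ((w y).smooth (l + 1 : ℕ)).iteratedFDeriv_right (by norm_cast; omega)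
        exact (this.differentiable one_ne_zero z).hasFDerivAt
    have h3 : iteratedFDeriv ℝ l W = fun x => ∫ y, iteratedFDeriv ℝ l (w y) x ∂μ := funext ih
    simp_rw [h1, h3, h2.fderiv]
    exact (ContinuousLinearEquiv.integral_comp_comm (𝕜 := ℝ) (E := E →L[ℝ] (E [×l]→L[ℝ] ℂ))
      (F := E [×(l + 1)]→L[ℝ] ℂ) (continuousMultilinearCurryLeftEquiv ℝ (fun _ : Fin (l + 1) => E)
      ℂ).symm.toContinuousLinearEquiv (μ := μ)
      (fun y => fderiv ℝ (iteratedFDeriv ℝ l (w y)) x)).symm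

/-- A tempered distribution commutes with the integral of a continuous family of Schwartz
functions whose seminorms are integrable. -/
theorem integrable_and_eq_integral (U : 𝓢(E, ℂ) →L[ℂ] ℂ) {w : Y → 𝓢(E, ℂ)} (hw : Continuous w)
    (hint : ∀ k l, Integrable (fun y => SchwartzMap.seminorm ℂ k l (w y)) μ)
    {W : 𝓢(E, ℂ)} (hW : ∀ x, W x = ∫ y, w y x ∂μ) :
    Integrable (fun y => U (w y)) μ ∧ U W = ∫ y, U (w y) ∂μ := by
  obtain ⟨s, Λ, hΛ⟩ := exists_factor_weightedDerivs U
  -- The target is not separable in general; continuity on the second countable space `Y` still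
  -- gives strong measurability.
  have hi : Integrable (fun y => weightedDerivs s (w y)) μ :=
    (integrable_finsetSum s fun m _ => hint m.1 m.2).mono'
      ((weightedDerivs s).continuous.comp hw).aestronglyMeasurable
      (.of_forall fun y => norm_weightedDerivs_le s (w y))
  -- Checked coordinatewise: each evaluation is continuous and linear, so it commutes with the
  -- Bochner integral.
  have hAW : weightedDerivs s W = ∫ y, weightedDerivs s (w y) ∂μ := by
    ext1
    funext i
    have h := (lp.evalCLM ℂ (fun i : s × E => E [×i.1.1.2]→L[ℝ] ℂ) ∞ i).integral_comp_comm hi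
    have h' : (lp.evalCLM ℂ (fun i : s × E => E [×i.1.1.2]→L[ℝ] ℂ) ∞ i)
      (∫ y, weightedDerivs s (w y) ∂μ) = (∫ y, weightedDerivs s (w y) ∂μ :
        lp (fun i : s × E => E [×i.1.1.2]→L[ℝ] ℂ) ∞) i := rfl
    rw [← h', ← h, weightedDerivs_apply, iteratedFDeriv_eq_integral hw hint hW, ← integral_smul]
    rfl
  simp_rw [hΛ]
  exact ⟨Λ.integrable_comp hi, by rw [hAW, Λ.integral_comp_comm hi]⟩

end Exchange

/-! ### Translations and products of Schwartz functions -/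

section Translation

variable {E : Type*} [NormedAddCommGroup E] [NormedSpace ℝ E]

/-- The translate `x ↦ u (x - a)` of a Schwartz function. -/
abbrev translate (a : E) (u : 𝓢(E, ℂ)) : 𝓢(E, ℂ) := SchwartzMap.compSubConstCLM ℂ a u

/-- The pointwise product of two Schwartz functions. -/
abbrev mulS (g h : 𝓢(E, ℂ)) : 𝓢(E, ℂ) := SchwartzMap.smulLeftCLM ℂ g h

theorem mulS_apply (g h : 𝓢(E, ℂ)) (x : E) : mulS g h x = g x * h x := by
  rw [mulS, SchwartzMap.smulLeftCLM_apply_apply g.hasTemperateGrowth, smul_eq_mul]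

theorem translate_apply (a : E) (u : 𝓢(E, ℂ)) (x : E) : translate a u x = u (x - a) :=
  SchwartzMap.compSubConstCLM_apply u a x

theorem iteratedFDeriv_translate (a : E) (u : 𝓢(E, ℂ)) (l : ℕ) (x : E) :
    iteratedFDeriv ℝ l (translate a u) x = iteratedFDeriv ℝ l u (x - a) := by
  rw [← iteratedFDeriv_comp_sub]
  rfl

/-- The seminorm dominating all `(1 + ‖x‖) ^ k ‖D ^ l u (x)‖`, up to a factor. -/
def supSeminorm (k l : ℕ) : Seminorm ℂ 𝓢(E, ℂ) :=
  (Finset.Iic (k, l)).sup fun m => SchwartzMap.seminorm ℂ m.1 m.2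

theorem le_supSeminorm {k l k' l' : ℕ} (hk : k' ≤ k) (hl : l' ≤ l) (u : 𝓢(E, ℂ)) (x : E) :
    (1 + ‖x‖) ^ k' * ‖iteratedFDeriv ℝ l' u x‖ ≤ 2 ^ k * supSeminorm k l u :=
  SchwartzMap.one_add_le_sup_seminorm_apply (𝕜 := ℂ) (m := (k, l)) hk hl u x

theorem continuous_supSeminorm (k l : ℕ) : Continuous (supSeminorm (E := E) k l) := by
  unfold supSeminorm
  induction Finset.Iic (k, l) using Finset.induction_on with
  | empty => exact continuous_const
  | insert m s _ ih =>
    rw [Finset.sup_insert]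
    exact ((schwartz_withSeminorms ℂ E ℂ).continuous_seminorm m).sup ih

theorem one_add_norm_le_mul {E : Type*} [NormedAddCommGroup E] (x a : E) : 1 + ‖x‖ ≤ (1 + ‖a‖) * (1 + ‖x - a‖) := by
  have h1 := norm_le_norm_add_norm_sub' x a
  have h2 := norm_nonneg a
  have h3 := norm_nonneg (x - a)
  nlinarith [mul_nonneg h2 h3]

/-- Translation costs only polynomial growth in `a`, since the weight at `x` is at most `(1 + ‖a‖) ^
k` times the weight at `x - a`. -/
theorem seminorm_translate_le (k l : ℕ) (a : E) (u : 𝓢(E, ℂ)) :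
    SchwartzMap.seminorm ℂ k l (translate a u) ≤
      (1 + ‖a‖) ^ k * (2 ^ k * supSeminorm k l u) := by
  refine SchwartzMap.seminorm_le_bound ℂ _ _ _ (by positivity) fun x => ?_
  rw [iteratedFDeriv_translate]
  calc ‖x‖ ^ k * ‖iteratedFDeriv ℝ l u (x - a)‖
      ≤ ((1 + ‖a‖) * (1 + ‖x - a‖)) ^ k * ‖iteratedFDeriv ℝ l u (x - a)‖ := by
        gcongr
        exact (by linarith : ‖x‖ ≤ 1 + ‖x‖).trans (one_add_norm_le_mul x a)
    _ = (1 + ‖a‖) ^ k * ((1 + ‖x - a‖) ^ k * ‖iteratedFDeriv ℝ l u (x - a)‖) := by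
        rw [mul_pow]
        ring
    _ ≤ _ := mul_le_mul_of_nonneg_left (le_supSeminorm le_rfl le_rfl u _) (by positivity)

/-- Mean value inequality on the unit ball around `x`, where the weights are comparable. One factor
`2 ^ k` comes from this comparison, the other from `le_supSeminorm`. -/
theorem seminorm_translate_sub_le (k l : ℕ) {a : E} (ha : ‖a‖ ≤ 1) (u : 𝓢(E, ℂ)) :
    SchwartzMap.seminorm ℂ k l (translate a u - u) ≤
      ‖a‖ * (2 ^ k * (2 ^ k * supSeminorm k (l + 1) u)) := by
  refine SchwartzMap.seminorm_le_bound ℂ _ _ _ (by positivity) fun x => ?_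
  have h0 : iteratedFDeriv ℝ l (translate a u - u : 𝓢(E, ℂ)) x =
      iteratedFDeriv ℝ l u (x - a) - iteratedFDeriv ℝ l u x := by
    rw [← iteratedFDeriv_translate]
    exact iteratedFDeriv_sub_apply ((translate a u).smooth _).contDiffAt (u.smooth _).contDiffAt
  set M := 2 ^ k * (2 ^ k * supSeminorm k (l + 1) u) with hM
  have hd : Differentiable ℝ (iteratedFDeriv ℝ l u) :=
    ((u.smooth (l + 1 : ℕ)).iteratedFDeriv_right (m := 1) (by norm_cast; omega)).differentiable
      one_ne_zero
  have hb : ∀ z ∈ Metric.closedBall x 1,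
      ‖fderiv ℝ (iteratedFDeriv ℝ l u) z‖ ≤ M / (1 + ‖x‖) ^ k := fun z hz => by
    rw [norm_fderiv_iteratedFDeriv, le_div_iff₀ (by positivity), mul_comm]
    have h1 : 1 + ‖x‖ ≤ 2 * (1 + ‖z‖) := by
      have := norm_le_norm_add_norm_sub' x z
      have h2 : ‖x - z‖ ≤ 1 := by simpa [dist_eq_norm, norm_sub_rev] using hz
      linarith [norm_nonneg z]
    calc (1 + ‖x‖) ^ k * ‖iteratedFDeriv ℝ (l + 1) u z‖
        ≤ (2 * (1 + ‖z‖)) ^ k * ‖iteratedFDeriv ℝ (l + 1) u z‖ := by gcongr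
      _ = 2 ^ k * ((1 + ‖z‖) ^ k * ‖iteratedFDeriv ℝ (l + 1) u z‖) := by
        rw [mul_pow]
        ring
      _ ≤ M := mul_le_mul_of_nonneg_left (le_supSeminorm le_rfl le_rfl u z) (by positivity)
  have hmv := (convex_closedBall x 1).norm_image_sub_le_of_norm_fderiv_le (𝕜 := ℝ)
    (fun z _ => hd z) hb (Metric.mem_closedBall_self zero_le_one)
    (y := x - a) (by simpa [dist_eq_norm] using ha)
  rw [h0]
  calc _ ≤ (1 + ‖x‖) ^ k * (M / (1 + ‖x‖) ^ k * ‖x - a - x‖) := by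
        gcongr
        linarith
    _ = ‖a‖ * M := by
        have : ‖x - a - x‖ = ‖a‖ := by simp
        rw [this]
        field_simp

theorem translate_add (a b : E) (u : 𝓢(E, ℂ)) :
    translate (a + b) u = translate a (translate b u) := by
  ext x
  simp only [translate_apply]
  congr 1
  abel

/-- Translation is jointly continuous on the Schwartz space. -/
theorem continuous_translate : Continuous fun z : E × 𝓢(E, ℂ) => translate z.1 z.2 := by
  refine continuous_iff_continuousAt.2 fun z₀ => ?_
  obtain ⟨a₀, u₀⟩ := z₀
  refine ((schwartz_withSeminorms ℂ E ℂ).tendsto_nhds _ _).2 ?_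
  rintro ⟨k, l⟩ ε hε
  have hle : ∀ z : E × 𝓢(E, ℂ), ‖z.1 - a₀‖ ≤ 1 →
      SchwartzMap.seminorm ℂ k l (translate z.1 z.2 - translate a₀ u₀) ≤
        (1 + ‖z.1‖) ^ k * (2 ^ k * supSeminorm k l (z.2 - u₀)) +
        ‖z.1 - a₀‖ * (2 ^ k * (2 ^ k * supSeminorm k (l + 1) (translate a₀ u₀))) := by
    rintro ⟨a, u⟩ h
    -- The change of the function and the change of the translation vector are separated; the second
    -- compares one fixed function with a small translate of itself.
    have h1 : translate a u - translate a₀ u₀ =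
        translate a (u - u₀) + (translate (a - a₀) (translate a₀ u₀) - translate a₀ u₀) := by
      rw [← translate_add, sub_add_cancel, translate, translate, translate, map_sub]
      abel
    rw [h1]
    exact (map_add_le_add _ _ _).trans (add_le_add (seminorm_translate_le k l a _)
      (seminorm_translate_sub_le k l h _))
  have hlim : Filter.Tendsto (fun z : E × 𝓢(E, ℂ) =>
      (1 + ‖z.1‖) ^ k * (2 ^ k * supSeminorm k l (z.2 - u₀)) +
        ‖z.1 - a₀‖ * (2 ^ k * (2 ^ k * supSeminorm k (l + 1) (translate a₀ u₀))))
      (nhds (a₀, u₀)) (nhds 0) := by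
    have hc : Continuous (fun z : E × 𝓢(E, ℂ) =>
      (1 + ‖z.1‖) ^ k * (2 ^ k * supSeminorm k l (z.2 - u₀)) +
        ‖z.1 - a₀‖ * (2 ^ k * (2 ^ k * supSeminorm k (l + 1) (translate a₀ u₀)))) := by
      have := (continuous_supSeminorm (E := E) k l).comp
        ((continuous_snd (X := E) (Y := 𝓢(E, ℂ))).sub (continuous_const (y := u₀)))
      simp only [Function.comp_def] at this
      fun_prop
    have := hc.tendsto (a₀, u₀)
    simpa using this
  have hnear : ∀ᶠ z : E × 𝓢(E, ℂ) in nhds (a₀, u₀), ‖z.1 - a₀‖ ≤ 1 := by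
    have hc : Continuous fun z : E × 𝓢(E, ℂ) => ‖z.1 - a₀‖ := by fun_prop
    exact (hc.tendsto (a₀, u₀)).eventually_le_const (by simp)
  filter_upwards [hnear, hlim.eventually_lt_const hε] with z h1 h2
  exact (hle z h1).trans_lt h2

/-- The product of a Schwartz function with a far translate of another one is small. -/
theorem exists_seminorm_mulS_translate_le (g h : 𝓢(E, ℂ)) (N k l : ℕ) :
    ∃ C : ℝ, 0 ≤ C ∧ ∀ a : E,
      (1 + ‖a‖) ^ N * SchwartzMap.seminorm ℂ k l (mulS (translate a g) h) ≤ C := by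
  set B := ∑ i ∈ Finset.range (l + 1), (l.choose i : ℝ) * (2 ^ N * supSeminorm N l g) *
    (2 ^ (N + k) * supSeminorm (N + k) l h) with hB
  have hB0 : 0 ≤ B := by positivity
  refine ⟨B, hB0, fun a => ?_⟩
  rw [← le_div_iff₀' (by positivity)]
  refine SchwartzMap.seminorm_le_bound ℂ _ _ _ (by positivity) fun x => ?_
  rw [le_div_iff₀' (by positivity)]
  have h1 : (mulS (translate a g) h : E → ℂ) = fun y => translate a g y * h y :=
    funext fun y => mulS_apply _ _ y
  have h2 := norm_iteratedFDeriv_mul_le ((translate a g).smooth l) (h.smooth l) x (n := l) le_rfl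
  rw [h1]
  -- If `a` is large then `x` or `x - a` is large, so the weight in `a` is paid for by the decay of
  -- `h` and of `g` in the Leibniz expansion.
  have h3 : 1 + ‖a‖ ≤ (1 + ‖x‖) * (1 + ‖x - a‖) := by
    have := one_add_norm_le_mul a x
    rwa [norm_sub_rev a x] at this
  calc (1 + ‖a‖) ^ N * (‖x‖ ^ k * ‖iteratedFDeriv ℝ l (fun y => translate a g y * h y) x‖)
      ≤ ((1 + ‖x‖) * (1 + ‖x - a‖)) ^ N * ((1 + ‖x‖) ^ k * ∑ i ∈ Finset.range (l + 1),
        (l.choose i : ℝ) * ‖iteratedFDeriv ℝ i (translate a g) x‖ *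
          ‖iteratedFDeriv ℝ (l - i) h x‖) := by
        gcongr
        linarith
    _ = ∑ i ∈ Finset.range (l + 1), (l.choose i : ℝ) *
        ((1 + ‖x - a‖) ^ N * ‖iteratedFDeriv ℝ i g (x - a)‖) *
          ((1 + ‖x‖) ^ (N + k) * ‖iteratedFDeriv ℝ (l - i) h x‖) := by
        rw [Finset.mul_sum, Finset.mul_sum]
        refine Finset.sum_congr rfl fun i _ => ?_
        rw [iteratedFDeriv_translate, mul_pow, pow_add]
        ring
    _ ≤ B := by
        rw [hB]
        refine Finset.sum_le_sum fun i hi => ?_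
        have hi' : i ≤ l := Finset.mem_range_succ_iff.1 hi
        exact mul_le_mul (mul_le_mul_of_nonneg_left (le_supSeminorm le_rfl hi' g _)
          (by positivity)) (le_supSeminorm le_rfl (Nat.sub_le _ _) h _)
          (by positivity) (by positivity)

/-- Every continuous seminorm of the product decays, in the sense of
`exists_seminorm_mulS_translate_le`. -/
theorem exists_mulS_translate_le (g h : 𝓢(E, ℂ)) (N : ℕ) (T : 𝓢(E, ℂ) →L[ℂ] 𝓢(E, ℂ)) (k l : ℕ) :
    ∃ C : ℝ, 0 ≤ C ∧ ∀ a : E,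
      (1 + ‖a‖) ^ N * SchwartzMap.seminorm ℂ k l (T (mulS (translate a g) h)) ≤ C := by
  obtain ⟨s, K, -, hK⟩ := Seminorm.bound_of_continuous (schwartz_withSeminorms ℂ E ℂ)
    ((schwartzSeminormFamily ℂ E ℂ (k, l)).comp T.toLinearMap)
    (((schwartz_withSeminorms ℂ E ℂ).continuous_seminorm (k, l)).comp T.continuous)
  choose C hC0 hC using fun m : ℕ × ℕ => exists_seminorm_mulS_translate_le g h N m.1 m.2
  refine ⟨K * ∑ m ∈ s, C m, mul_nonneg K.2 (Finset.sum_nonneg fun m _ => hC0 m), fun a => ?_⟩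
  have h1 := hK (mulS (translate a g) h)
  rw [smul_apply] at h1
  have h2 : (1 + ‖a‖) ^ N * s.sup (schwartzSeminormFamily ℂ E ℂ) (mulS (translate a g) h) ≤
      ∑ m ∈ s, C m := by
    rw [← le_div_iff₀' (by positivity)]
    refine Seminorm.finset_sup_apply_le
      (div_nonneg (Finset.sum_nonneg fun m _ => hC0 m) (by positivity)) fun m hm => ?_
    rw [le_div_iff₀' (by positivity)]
    exact (hC m a).trans (Finset.single_le_sum (f := C) (fun m _ => hC0 m) hm)
  calc _ ≤ (1 + ‖a‖) ^ N *
        (K * s.sup (schwartzSeminormFamily ℂ E ℂ) (mulS (translate a g) h)) := by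
        gcongr
        exact h1
    _ = K * ((1 + ‖a‖) ^ N * s.sup (schwartzSeminormFamily ℂ E ℂ) (mulS (translate a g) h)) := by
        ring
    _ ≤ _ := by gcongr

end Translation

/-! ### Modulations and the Fourier transform -/

section Fourier

variable {n : ℕ}

local notation "𝔼" => EuclideanSpace ℝ (Fin n)

theorem normFactor_sq_mul (n : ℕ) :
    normFactor n * normFactor n * (((2 * Real.pi) ^ n : ℝ) : ℂ) = 1 := by
  have hpos : (0 : ℝ) < 2 * Real.pi := by positivity
  rw [normFactor, ← Complex.ofReal_mul, ← Complex.ofReal_mul, ← Real.rpow_add hpos,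
    ← Real.rpow_natCast (2 * Real.pi) n, ← Real.rpow_add hpos, ← Complex.ofReal_one]
  congr 1
  rw [← Real.rpow_zero (2 * Real.pi)]
  congr 1
  ring

theorem normFactor_ne_zero (n : ℕ) : normFactor n ≠ 0 := by
  intro h
  simpa [h] using normFactor_sq_mul n

theorem fourierInvS_fourierS (u : 𝓢(𝔼, ℂ)) : fourierInvS n (fourierS n u) = u := by
  ext x
  have h1 : ∀ ξ, fourierS n u ξ = normFactor n * (𝓕 u) ((2 * Real.pi)⁻¹ • ξ) := fun ξ => rfl
  have h2 : u x = ∫ η, Complex.exp (Complex.I * (inner ℝ x ((2 * Real.pi) • η) : ℝ)) * (𝓕 u) η := by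
    have h : u x = (𝓕⁻ (𝓕 u)) x := by rw [FourierTransform.fourierInv_fourier_eq]
    rw [h, SchwartzMap.fourierInv_coe, Real.fourierInv_eq']
    congr 1
    ext η
    rw [smul_eq_mul, real_inner_smul_right, real_inner_comm]
    congr 2
    push_cast
    ring
  -- The dilation by `(2π)⁻¹` contributes the Jacobian `(2π)^n`, which cancels the square of
  -- `normFactor n`.
  have h3 := Measure.integral_comp_smul (μ := (volume : Measure 𝔼))
    (fun η => Complex.exp (Complex.I * (inner ℝ x ((2 * Real.pi) • η) : ℝ)) * (𝓕 u) η)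
    (2 * Real.pi)⁻¹
  rw [← h2, finrank_euclideanSpace_fin] at h3
  rw [fourierInvS_apply]
  simp_rw [h1]
  have h4 : ∀ ξ : 𝔼, normFactor n * (𝓕 u) ((2 * Real.pi)⁻¹ • ξ) *
      Complex.exp (Complex.I * (inner ℝ x ξ : ℝ)) = normFactor n *
      (Complex.exp (Complex.I * (inner ℝ x ((2 * Real.pi) • (2 * Real.pi)⁻¹ • ξ) : ℝ)) *
        (𝓕 u) ((2 * Real.pi)⁻¹ • ξ)) := fun ξ => by
    rw [smul_inv_smul₀ (by positivity)]
    ring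
  simp_rw [h4]
  rw [integral_const_mul, h3, inv_pow, inv_inv, abs_of_pos (by positivity), Complex.real_smul,
    ← mul_assoc, ← mul_assoc, normFactor_sq_mul, one_mul]

theorem fourierS_apply_eq_fourierInvS_neg (u : 𝓢(𝔼, ℂ)) (x : 𝔼) :
    fourierS n u x = fourierInvS n u (-x) := by
  rw [fourierS_apply, fourierInvS_apply]
  congr 2
  ext y
  rw [inner_neg_left, real_inner_comm]
  push_cast
  ring_nf

/-- The two transforms differ by a reflection, so this follows from the other inversion formula by
the substitution `y ↦ -y`. -/
theorem fourierS_fourierInvS (u : 𝓢(𝔼, ℂ)) : fourierS n (fourierInvS n u) = u := by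
  ext x
  have h : fourierInvS n (fourierS n u) x = u x := by rw [fourierInvS_fourierS]
  rw [fourierS_apply, ← integral_neg_eq_self]
  rw [fourierInvS_apply] at h
  refine Eq.trans ?_ h
  congr 2
  ext y
  rw [fourierS_apply_eq_fourierInvS_neg, inner_neg_left, real_inner_comm]
  push_cast
  ring_nf

/-- The product `η ↦ e ^ {i η·x} m(η)`. -/
def modulate (x : 𝔼) (m : 𝓢(𝔼, ℂ)) : 𝓢(𝔼, ℂ) := SchwartzMap.smulLeftCLM ℂ (character (-x)) m

theorem modulate_apply (x : 𝔼) (m : 𝓢(𝔼, ℂ)) (η : 𝔼) :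
    modulate x m η = Complex.exp (Complex.I * (inner ℝ η x : ℝ)) * m η := by
  rw [modulate, SchwartzMap.smulLeftCLM_apply_apply (character_hasTemperateGrowth _), smul_eq_mul,
    character, inner_neg_right]
  push_cast
  ring_nf

/-- The Fourier transform turns modulation into translation. Continuity and seminorm growth of
modulations are deduced from those of translations in this way. -/
theorem modulate_eq (x : 𝔼) (m : 𝓢(𝔼, ℂ)) :
    modulate x m = fourierInvS n (translate x (fourierS n m)) := by
  ext η
  have h : fourierInvS n (fourierS n m) η = m η := by rw [fourierInvS_fourierS]
  rw [modulate_apply, ← h, fourierInvS_apply, fourierInvS_apply]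
  simp_rw [translate_apply]
  rw [← integral_add_right_eq_self (μ := volume) (fun ξ => fourierS n m (ξ - x) *
    Complex.exp (Complex.I * (inner ℝ η ξ : ℝ))) x]
  simp_rw [add_sub_cancel_right, inner_add_right, Complex.ofReal_add, mul_add, Complex.exp_add]
  rw [mul_left_comm, ← integral_const_mul]
  congr 2
  ext ξ
  ring

theorem continuous_modulate : Continuous fun z : 𝔼 × 𝓢(𝔼, ℂ) => modulate z.1 z.2 := by
  simp_rw [modulate_eq]
  exact (fourierInvS n).continuous.comp (continuous_translate.comp
    (continuous_fst.prodMk ((fourierS n).continuous.comp continuous_snd)))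

theorem continuous_modulate_left (m : 𝓢(𝔼, ℂ)) : Continuous fun y : 𝔼 => modulate y m := by
  have h := (continuous_modulate (n := n)).comp (f := fun y : 𝔼 => (y, m)) (by fun_prop)
  simpa only [Function.comp_def] using h

theorem exists_seminorm_modulate_le (m : 𝓢(𝔼, ℂ)) (k l : ℕ) :
    ∃ (C : ℝ) (J : ℕ), 0 ≤ C ∧
      ∀ x, SchwartzMap.seminorm ℂ k l (modulate x m) ≤ C * (1 + ‖x‖) ^ J := by
  obtain ⟨s, K, -, hK⟩ := Seminorm.bound_of_continuous (schwartz_withSeminorms ℂ 𝔼 ℂ)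
    ((schwartzSeminormFamily ℂ 𝔼 ℂ (k, l)).comp (fourierInvS n).toLinearMap)
    (((schwartz_withSeminorms ℂ 𝔼 ℂ).continuous_seminorm (k, l)).comp (fourierInvS n).continuous)
  set v := fourierS n m
  have hnn : ∀ i : ℕ × ℕ, 0 ≤ 2 ^ i.1 * supSeminorm i.1 i.2 v := fun i => by positivity
  refine ⟨K * ∑ i ∈ s, (2 ^ i.1 * supSeminorm i.1 i.2 v), ∑ i ∈ s, i.1,
    mul_nonneg K.2 (Finset.sum_nonneg fun i _ => hnn i), fun x => ?_⟩
  have h1 := hK (translate x v)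
  rw [modulate_eq]
  rw [smul_apply] at h1
  refine h1.trans ?_
  rw [mul_assoc]
  refine mul_le_mul_of_nonneg_left ?_ K.2
  refine Seminorm.finset_sup_apply_le
    (mul_nonneg (Finset.sum_nonneg fun i _ => hnn i) (by positivity)) fun i hi => ?_
  refine (seminorm_translate_le i.1 i.2 x v).trans ?_
  rw [mul_comm]
  refine mul_le_mul (Finset.single_le_sum (f := fun i : ℕ × ℕ => 2 ^ i.1 * supSeminorm i.1 i.2 v)
    (fun i _ => hnn i) hi) ?_ (by positivity) (Finset.sum_nonneg fun i _ => hnn i)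
  refine pow_le_pow_right₀ (by linarith [norm_nonneg x]) ?_
  exact Finset.single_le_sum (f := fun i : ℕ × ℕ => i.1) (fun _ _ => Nat.zero_le _) hi

theorem integrable_one_add_norm_pow_inv {N : ℕ} (hN : n < N) :
    Integrable fun x : 𝔼 => ((1 + ‖x‖) ^ N)⁻¹ := by
  have h := integrable_one_add_norm (E := 𝔼) (μ := volume) (r := N) (by
    rw [finrank_euclideanSpace_fin]
    exact_mod_cast hN)
  refine h.congr (.of_forall fun x => ?_)
  simp only [Real.rpow_neg (by positivity : 0 ≤ 1 + ‖x‖), Real.rpow_natCast]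

theorem one_add_norm_pow_mul_norm_le (u : 𝓢(𝔼, ℂ)) (N : ℕ) (x : 𝔼) :
    (1 + ‖x‖) ^ N * ‖u x‖ ≤ 2 ^ N * supSeminorm N 0 u := by
  simpa using le_supSeminorm (k := N) (l := 0) le_rfl le_rfl u x

theorem integrable_norm_mul_pow (u : 𝓢(𝔼, ℂ)) (J : ℕ) :
    Integrable fun x : 𝔼 => ‖u x‖ * (1 + ‖x‖) ^ J := by
  refine Integrable.mono'
    ((integrable_one_add_norm_pow_inv (N := n + 1) n.lt_add_one).const_mul
      -- Of the decay exponent, `J` compensates the weight and `n + 1` makes the bound integrable.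
      (2 ^ (n + 1 + J) * supSeminorm (n + 1 + J) 0 u))
    (Continuous.aestronglyMeasurable (by have := u.continuous; fun_prop))
    (.of_forall fun x => ?_)
  rw [Real.norm_of_nonneg (by positivity), ← div_eq_mul_inv, le_div_iff₀ (by positivity)]
  refine le_trans (le_of_eq ?_) (one_add_norm_pow_mul_norm_le u (n + 1 + J) x)
  rw [pow_add]
  ring

/-- `U (m · 𝓕⁻¹ u) = (2π)^{-n/2} ∫ u(y) U(e ^ {i y·} m) dy`. -/
theorem integrable_and_apply_mulS_fourierInvS (U : 𝓢(𝔼, ℂ) →L[ℂ] ℂ) (m u : 𝓢(𝔼, ℂ)) :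
    Integrable (fun y => u y * U (modulate y m)) ∧
      U (mulS m (fourierInvS n u)) = normFactor n * ∫ y, u y * U (modulate y m) := by
  have hmod : Continuous fun y : 𝔼 => modulate y m :=
    continuous_modulate_left m
  have hcu : Continuous fun y : 𝔼 => normFactor n * u y := continuous_const.mul u.continuous
  have hw : Continuous fun y : 𝔼 => (normFactor n * u y) • modulate y m := hcu.smul hmod
  have hint : ∀ k l, Integrable
      (fun y : 𝔼 => SchwartzMap.seminorm ℂ k l ((normFactor n * u y) • modulate y m)) := by
    intro k l
    obtain ⟨C, J, hC, hCJ⟩ := exists_seminorm_modulate_le m k l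
    refine Integrable.mono' ((integrable_norm_mul_pow u J).const_mul (‖normFactor n‖ * C))
      (Continuous.aestronglyMeasurable
        (((schwartz_withSeminorms ℂ 𝔼 ℂ).continuous_seminorm (k, l)).comp hw))
      (.of_forall fun y => ?_)
    rw [Real.norm_of_nonneg (apply_nonneg _ _), map_smul_eq_mul, norm_mul]
    calc _ ≤ ‖normFactor n‖ * ‖u y‖ * (C * (1 + ‖y‖) ^ J) := by
          gcongr
          exact hCJ y
      _ = _ := by ring
  have hW : ∀ x, mulS m (fourierInvS n u) x =
      ∫ y, ((normFactor n * u y) • modulate y m) x := by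
    intro x
    rw [mulS_apply, fourierInvS_apply, mul_left_comm, ← integral_const_mul, ← integral_const_mul]
    congr 1
    ext y
    rw [smul_apply, smul_eq_mul, modulate_apply, real_inner_comm]
    ring
  have h := integrable_and_eq_integral U hw hint hW
  simp only [map_smul, smul_eq_mul, mul_assoc] at h
  refine ⟨?_, by rw [h.2, integral_const_mul]⟩
  have h1 := h.1.const_mul (normFactor n)⁻¹
  simpa only [inv_mul_cancel_left₀ (normFactor_ne_zero n)] using h1

theorem modulate_modulate (x y : 𝔼) (m : 𝓢(𝔼, ℂ)) :
    modulate x (modulate y m) = modulate (x + y) m := by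
  ext η
  simp only [modulate_apply, inner_add_right, Complex.ofReal_add, mul_add, Complex.exp_add]
  ring

theorem modulate_mulS (x : 𝔼) (g m : 𝓢(𝔼, ℂ)) :
    modulate x (mulS g m) = mulS g (modulate x m) := by
  ext η
  simp only [modulate_apply, mulS_apply]
  ring

/-- The function `x ↦ U (e ^ {i x·} m₁ m₂)` is dominated by the convolution of `𝓕 m₁` with
`x ↦ U (e ^ {i x·} m₂)`. -/
theorem enorm_apply_modulate_mulS_le (U : 𝓢(𝔼, ℂ) →L[ℂ] ℂ) (g m : 𝓢(𝔼, ℂ)) (x : 𝔼) :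
    ‖U (modulate x (mulS g m))‖ₑ ≤
      ‖normFactor n‖ₑ * ∫⁻ y, ‖fourierS n g y‖ₑ * ‖U (modulate (x + y) m)‖ₑ := by
  -- Writing `g = 𝓕⁻¹ (𝓕 g)` makes the product a superposition of modulates of `m` with density `𝓕
  -- g`.
  have h1 : modulate x (mulS g m) = mulS (modulate x m) (fourierInvS n (fourierS n g)) := by
    rw [fourierInvS_fourierS, modulate_mulS]
    ext η
    simp only [mulS_apply]
    ring
  rw [h1, (integrable_and_apply_mulS_fourierInvS U _ _).2, enorm_mul]
  gcongr
  refine (enorm_integral_le_lintegral_enorm _).trans (le_of_eq ?_)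
  simp_rw [modulate_modulate, enorm_mul, add_comm x]

/-- The complex conjugate of a Schwartz function. -/
def conjS (u : 𝓢(𝔼, ℂ)) : 𝓢(𝔼, ℂ) :=
  SchwartzMap.postcompCLM (𝕜 := ℝ) (Complex.conjCLE : ℂ →L[ℝ] ℂ) u

theorem conjS_apply (u : 𝓢(𝔼, ℂ)) (x : 𝔼) : conjS u x = conj (u x) := rfl

/-- The fundamental identity of time-frequency analysis: on the Fourier side a time-frequency shift
is again one, with the roles of `x` and `ξ` exchanged and a phase factor. It lets the short-time
transform be read as a coefficient of `𝓕 f`. -/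
theorem timeFreqShift_eq (φ : 𝓢(𝔼, ℂ)) (x ξ : 𝔼) :
    timeFreqShift φ x ξ = character ξ x •
      fourierS n (modulate x (translate ξ (conjS (fourierS n φ)))) := by
  rw [← map_smul, ← fourierS_fourierInvS (timeFreqShift φ x ξ)]
  congr 1
  ext η
  rw [smul_apply, smul_eq_mul, modulate_apply, translate_apply, conjS_apply, fourierInvS_apply,
    fourierS_apply, map_mul, ← integral_conj]
  -- Shifting `t` by `x` centres the window, so that both sides become integrals of `conj (φ t)`
  -- against exponentials.
  rw [← integral_add_right_eq_self (μ := volume) (fun t => timeFreqShift φ x ξ t *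
    Complex.exp (Complex.I * (inner ℝ η t : ℝ))) x]
  have hc : conj (normFactor n) = normFactor n := Complex.conj_ofReal _
  rw [hc, mul_left_comm (Complex.exp _), mul_left_comm (character ξ x)]
  congr 1
  rw [← integral_const_mul, ← integral_const_mul]
  congr 1
  ext t
  have h1 : conj (Complex.exp (-Complex.I * (inner ℝ t (η - ξ) : ℝ))) =
      Complex.exp (Complex.I * (inner ℝ t (η - ξ) : ℝ)) := by
    rw [← Complex.exp_conj]
    simp
  rw [timeFreqShift_apply, add_sub_cancel_right, map_mul, h1, character]
  have h2 : ∀ a b c d e f : ℂ, c + d = e + f + b → a * Complex.exp c * Complex.exp d =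
      Complex.exp e * (Complex.exp f * (a * Complex.exp b)) := by
    intro a b c d e f h
    rw [mul_assoc, ← Complex.exp_add, h, Complex.exp_add, Complex.exp_add]
    ring
  refine h2 _ _ _ _ _ _ ?_
  rw [inner_add_left, inner_add_right, inner_sub_right, real_inner_comm η t]
  push_cast
  ring

theorem norm_character (ξ x : 𝔼) : ‖character ξ x‖ = 1 := by
  rw [character, Complex.norm_exp]
  simp

theorem enorm_stft (φ : 𝓢(𝔼, ℂ)) (f : 𝓢'(𝔼, ℂ)) (x ξ : 𝔼) :
    ‖stft φ f x ξ‖ₑ =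
      ‖normFactor n‖ₑ * ‖fourierD n f (modulate x (translate ξ (conjS (fourierS n φ))))‖ₑ := by
  have h : ‖character ξ x‖ₑ = 1 := by
    rw [← ofReal_norm, norm_character, ENNReal.ofReal_one]
  rw [stft, timeFreqShift_eq, map_smul, smul_eq_mul, enorm_mul, enorm_mul, h, one_mul]
  rfl

end Fourier

/-! ### Integral inequalities -/

section Inequalities

variable {X Y Z : Type*} [MeasurableSpace X] [MeasurableSpace Y] [MeasurableSpace Z]

/-- With `I = ∫ g ^ r` and `M` the right-hand side, factor `g ^ r = g * (g ^ r) ^ (1 - 1 / r)`,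
insert the bound for one factor `g`, and use Tonelli and Hölder to get `I ≤ M * I ^ (1 - 1 / r)`.
Finiteness of `I` permits the division. -/
theorem lintegral_rpow_le_of_le {μ : Measure X} [SFinite μ] {ν : Measure Z} [SFinite ν]
    {H : X → Z → ℝ≥0∞} (hH : Measurable (Function.uncurry H)) {r : ℝ} (hr : 1 ≤ r)
    {g : X → ℝ≥0∞} (hg : Measurable g) (hgH : ∀ x, g x ≤ ∫⁻ z, H x z ∂ν)
    (hfin : ∫⁻ x, g x ^ r ∂μ ≠ ∞) :
    (∫⁻ x, g x ^ r ∂μ) ^ (1 / r) ≤ ∫⁻ z, (∫⁻ x, H x z ^ r ∂μ) ^ (1 / r) ∂ν := by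
  have hr0 : 0 < r := by linarith
  have hr1 : 0 ≤ 1 - 1 / r := by
    have : 1 / r ≤ 1 := by rwa [div_le_one hr0]
    linarith
  set I := ∫⁻ x, g x ^ r ∂μ with hI
  set M := ∫⁻ z, (∫⁻ x, H x z ^ r ∂μ) ^ (1 / r) ∂ν with hM
  have hpow : ∀ t : ℝ≥0∞, (t ^ r) ^ (1 / r) = t := fun t => by
    rw [← ENNReal.rpow_mul, mul_one_div_cancel hr0.ne', ENNReal.rpow_one]
  have hsplit : ∀ t : ℝ≥0∞, t ^ r = t * (t ^ r) ^ (1 - 1 / r) := fun t => by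
    rw [← ENNReal.rpow_mul]
    have h1 : r * (1 - 1 / r) = r - 1 := by field_simp
    have h2 : t ^ r = t ^ (1 + (r - 1)) := by ring_nf
    rw [h1, h2, ENNReal.rpow_add_of_nonneg _ _ zero_le_one (by linarith), ENNReal.rpow_one]
  have hHz : ∀ z, Measurable fun x => H x z := fun z => hH.comp (measurable_id.prodMk measurable_const)
  have hHx : ∀ x, Measurable fun z => H x z := fun x => hH.comp (measurable_const.prodMk measurable_id)
  have key : I ≤ M * I ^ (1 - 1 / r) := by
    calc I ≤ ∫⁻ x, ∫⁻ z, H x z * (g x ^ r) ^ (1 - 1 / r) ∂ν ∂μ := by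
          refine lintegral_mono fun x => ?_
          rw [lintegral_mul_const _ (hHx x)]
          calc g x ^ r = g x * (g x ^ r) ^ (1 - 1 / r) := hsplit _
            _ ≤ _ := by
              gcongr
              exact hgH x
      _ = ∫⁻ z, ∫⁻ x, H x z * (g x ^ r) ^ (1 - 1 / r) ∂μ ∂ν := by
          refine lintegral_lintegral_swap (Measurable.aemeasurable ?_)
          exact hH.mul (((hg.comp measurable_fst).pow_const r).pow_const _)
      _ ≤ ∫⁻ z, (∫⁻ x, H x z ^ r ∂μ) ^ (1 / r) * I ^ (1 - 1 / r) ∂ν := by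
          refine lintegral_mono fun z => ?_
          refine le_trans (le_of_eq ?_) (ENNReal.lintegral_mul_norm_pow_le
            ((hHz z).pow_const r).aemeasurable (hg.pow_const r).aemeasurable
            (p := 1 / r) (q := 1 - 1 / r) (by positivity) hr1 (by ring))
          refine lintegral_congr fun x => ?_
          rw [hpow]
      _ = M * I ^ (1 - 1 / r) := by
          refine lintegral_mul_const _ (Measurable.pow_const ?_ _)
          exact Measurable.lintegral_prod_left' (hH.pow_const r)
  rcases eq_or_ne I 0 with h0 | h0
  · rw [h0, ENNReal.zero_rpow_of_pos (by positivity)]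
    exact zero_le
  · have hne : I ^ (1 - 1 / r) ≠ 0 := by
      simp [ENNReal.rpow_eq_zero_iff, h0, hfin]
    have hne' : I ^ (1 - 1 / r) ≠ ∞ := ENNReal.rpow_ne_top_of_nonneg hr1 hfin
    rw [← ENNReal.mul_le_mul_iff_left hne hne', ← ENNReal.rpow_add_of_nonneg _ _ (by positivity) hr1]
    simpa using key

/-- **Minkowski's integral inequality**. -/
theorem lintegral_rpow_lintegral_le {μ : Measure X} [SigmaFinite μ] {ν : Measure Z} [SFinite ν]
    {H : X → Z → ℝ≥0∞} (hH : Measurable (Function.uncurry H)) {r : ℝ} (hr : 1 ≤ r) :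
    (∫⁻ x, (∫⁻ z, H x z ∂ν) ^ r ∂μ) ^ (1 / r) ≤
      ∫⁻ z, (∫⁻ x, H x z ^ r ∂μ) ^ (1 / r) ∂ν := by
  have hr0 : 0 < r := by linarith
  set M := ∫⁻ z, (∫⁻ x, H x z ^ r ∂μ) ^ (1 / r) ∂ν
  set G : X → ℝ≥0∞ := fun x => ∫⁻ z, H x z ∂ν with hG
  have hGm : Measurable G := Measurable.lintegral_prod_right' hH
  -- Truncation in height and to sets of finite measure makes the `r`-th power integrable; monotone
  -- convergence removes it.
  let g : ℕ → X → ℝ≥0∞ := fun j => (spanningSets μ j).indicator fun x => min (G x) j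
  have hgm : ∀ j, Measurable (g j) := fun j =>
    (hGm.min measurable_const).indicator (measurableSet_spanningSets μ j)
  have hgle : ∀ j x, g j x ≤ G x := fun j x =>
    (Set.indicator_le_self' (fun _ _ => zero_le) x).trans (min_le_left _ _)
  have hbound : ∀ j, ∫⁻ x, g j x ^ r ∂μ ≤ M ^ r := fun j => by
    have hfin : ∫⁻ x, g j x ^ r ∂μ ≠ ∞ := by
      have hle : ∫⁻ x, g j x ^ r ∂μ ≤ ∫⁻ x, (spanningSets μ j).indicator
          (fun _ => (j : ℝ≥0∞) ^ r) x ∂μ := by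
        refine lintegral_mono fun x => ?_
        by_cases hx : x ∈ spanningSets μ j
        · simp only [g, Set.indicator_of_mem hx]
          gcongr
          exact min_le_right _ _
        · simp [g, Set.indicator_of_notMem hx, hr0]
      refine (hle.trans_lt ?_).ne
      rw [lintegral_indicator_const (measurableSet_spanningSets μ j)]
      exact ENNReal.mul_lt_top (ENNReal.rpow_lt_top_of_nonneg hr0.le (by simp))
        (measure_spanningSets_lt_top μ j)
    have h := lintegral_rpow_le_of_le hH hr (hgm j) (hgle j) hfin
    have h2 := ENNReal.rpow_le_rpow h hr0.le
    rwa [← ENNReal.rpow_mul, one_div_mul_cancel hr0.ne', ENNReal.rpow_one] at h2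
  have hmono : Monotone fun j x => g j x ^ r := by
    intro i j hij x
    refine ENNReal.rpow_le_rpow ?_ hr0.le
    refine (Set.indicator_le_indicator_of_subset (monotone_spanningSets μ hij)
      (fun _ => zero_le) x).trans (Set.indicator_le_indicator ?_)
    exact min_le_min le_rfl (by exact_mod_cast hij)
  have hsup : ∀ x, ⨆ j, g j x ^ r = G x ^ r := fun x => by
    refine le_antisymm (iSup_le fun j => ENNReal.rpow_le_rpow (hgle j x) hr0.le) ?_
    rw [← ENNReal.le_rpow_inv_iff hr0]
    refine le_of_forall_lt fun c hc => ?_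
    obtain ⟨m, hm⟩ := ENNReal.exists_nat_gt (hc.trans_le le_top).ne
    set j := max m (spanningSetsIndex μ x)
    have hx : x ∈ spanningSets μ j :=
      monotone_spanningSets μ (le_max_right _ _) (mem_spanningSetsIndex μ x)
    have h1 : c < g j x := by
      simp only [g, Set.indicator_of_mem hx]
      refine lt_min hc (hm.trans_le ?_)
      exact_mod_cast le_max_left _ _
    refine h1.trans_le ?_
    rw [ENNReal.le_rpow_inv_iff hr0]
    exact le_iSup (fun j => g j x ^ r) j
  rw [one_div, ENNReal.rpow_inv_le_iff hr0]
  calc ∫⁻ x, G x ^ r ∂μ = ∫⁻ x, ⨆ j, g j x ^ r ∂μ := by simp_rw [hsup]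
    _ = ⨆ j, ∫⁻ x, g j x ^ r ∂μ := lintegral_iSup (fun j => (hgm j).pow_const r) hmono
    _ ≤ M ^ r := iSup_le hbound

/-- **Schur's test**. -/
theorem eLpNorm_lintegral_kernel_le {μ : Measure X} [SFinite μ] {ν : Measure Y} [SFinite ν]
    {K : X → Y → ℝ≥0∞} (hK : Measurable (Function.uncurry K)) {F : Y → ℝ≥0∞} (hF : Measurable F)
    {A : ℝ≥0∞} (hA₁ : ∀ x, ∫⁻ y, K x y ∂ν ≤ A) (hA₂ : ∀ y, ∫⁻ x, K x y ∂μ ≤ A)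
    {q : ℝ≥0∞} (hq : 1 ≤ q) :
    eLpNorm (fun x => ∫⁻ y, K x y * F y ∂ν) q μ ≤ A * eLpNorm F q ν := by
  have hKx : ∀ x, Measurable fun y => K x y := fun x => hK.comp (measurable_const.prodMk measurable_id)
  have hKy : ∀ y, Measurable fun x => K x y := fun y => hK.comp (measurable_id.prodMk measurable_const)
  rcases eq_or_ne q ∞ with rfl | hq'
  · rw [eLpNorm_exponent_top, eLpNorm_exponent_top]
    refine essSup_le_of_ae_le _ (.of_forall fun x => ?_)
    simp only [enorm_eq_self]
    calc ∫⁻ y, K x y * F y ∂ν ≤ ∫⁻ y, K x y * eLpNormEssSup F ν ∂ν := by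
          refine lintegral_mono_ae ?_
          filter_upwards [enorm_ae_le_eLpNormEssSup F ν] with y hy
          gcongr
          simpa using hy
      _ = (∫⁻ y, K x y ∂ν) * eLpNormEssSup F ν := lintegral_mul_const _ (hKx x)
      _ ≤ _ := by
          gcongr
          exact hA₁ x
  · have hq0 : q ≠ 0 := (zero_lt_one.trans_le hq).ne'
    set r := q.toReal
    have hr : 1 ≤ r := by
      rw [← ENNReal.toReal_one]
      exact ENNReal.toReal_mono hq' hq
    have hr0 : 0 < r := by linarith
    have hr1 : 0 ≤ 1 - 1 / r := by
      have : 1 / r ≤ 1 := by rwa [div_le_one hr0]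
      linarith
    rw [eLpNorm_eq_lintegral_rpow_enorm_toReal hq0 hq', eLpNorm_eq_lintegral_rpow_enorm_toReal hq0 hq']
    simp only [enorm_eq_self]
    have hpt : ∀ x, (∫⁻ y, K x y * F y ∂ν) ^ r ≤ A ^ (r - 1) * ∫⁻ y, K x y * F y ^ r ∂ν := by
      intro x
      have h := ENNReal.lintegral_mul_norm_pow_le (μ := ν) (hKx x).aemeasurable
        ((hKx x).mul (hF.pow_const r)).aemeasurable
        (p := 1 - 1 / r) (q := 1 / r) hr1 (by positivity) (by ring)
      -- Hölder with the kernel split between both factors, so that its row integral appears to the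
      -- power `r - 1`; the column bound then supplies the last factor `A`.
      have h1 : ∀ y, K x y * F y = K x y ^ (1 - 1 / r) * (K x y * F y ^ r) ^ (1 / r) := fun y => by
        rw [ENNReal.mul_rpow_of_nonneg _ _ (by positivity : 0 ≤ 1 / r), ← mul_assoc,
          ← ENNReal.rpow_add_of_nonneg _ _ hr1 (by positivity), ← ENNReal.rpow_mul,
          mul_one_div_cancel hr0.ne']
        simp
      simp only [Pi.mul_apply] at h
      simp_rw [← h1] at h
      have h2 := ENNReal.rpow_le_rpow h hr0.le
      rw [ENNReal.mul_rpow_of_nonneg _ _ hr0.le, ← ENNReal.rpow_mul, ← ENNReal.rpow_mul,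
        one_div_mul_cancel hr0.ne', ENNReal.rpow_one] at h2
      refine h2.trans ?_
      have h3 : (1 - 1 / r) * r = r - 1 := by field_simp
      rw [h3]
      exact mul_le_mul_left (ENNReal.rpow_le_rpow (hA₁ x) (by linarith)) _
    calc (∫⁻ x, (∫⁻ y, K x y * F y ∂ν) ^ r ∂μ) ^ (1 / r)
        ≤ (∫⁻ x, A ^ (r - 1) * ∫⁻ y, K x y * F y ^ r ∂ν ∂μ) ^ (1 / r) := by
          gcongr with x
          exact hpt x
      _ ≤ (A ^ r * ∫⁻ y, F y ^ r ∂ν) ^ (1 / r) := by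
          gcongr
          have hm : Measurable (Function.uncurry fun x y => K x y * F y ^ r) :=
            hK.mul ((hF.comp measurable_snd).pow_const r)
          have hm' : Measurable fun x => ∫⁻ y, K x y * F y ^ r ∂ν :=
            Measurable.lintegral_prod_right' hm
          rw [lintegral_const_mul _ hm',
            lintegral_lintegral_swap hm.aemeasurable]
          have h4 : A ^ r = A ^ (r - 1) * A := by
            have : A ^ r = A ^ ((r - 1) + 1) := by ring_nf
            rw [this, ENNReal.rpow_add_of_nonneg _ _ (by linarith) zero_le_one, ENNReal.rpow_one]
          rw [h4, mul_assoc]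
          gcongr
          rw [← lintegral_const_mul _ (hF.pow_const r)]
          refine lintegral_mono fun y => ?_
          rw [lintegral_mul_const _ (hKy y)]
          gcongr
          exact hA₂ y
      _ = A * (∫⁻ y, F y ^ r ∂ν) ^ (1 / r) := by
          rw [ENNReal.mul_rpow_of_nonneg _ _ (by positivity), ← ENNReal.rpow_mul,
            mul_one_div_cancel hr0.ne', ENNReal.rpow_one]

end Inequalities

/-! ### Mixed norms of convolutions, and index spaces -/

section MixedNorm

variable {n : ℕ}

local notation "𝔼" => EuclideanSpace ℝ (Fin n)

variable {Y : Type*} [TopologicalSpace Y] [MeasurableSpace Y] [OpensMeasurableSpace Y]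

theorem enorm_le_eLpNorm_top {g : 𝔼 → ℂ} (hg : Continuous g) (t : 𝔼) :
    ‖g t‖ₑ ≤ eLpNorm g ∞ volume := by
  rw [eLpNorm_exponent_top]
  by_contra h
  rw [not_le] at h
  have hopen : IsOpen {t | eLpNormEssSup g volume < ‖g t‖ₑ} :=
    isOpen_lt continuous_const hg.enorm
  refine (hopen.measure_pos volume ⟨t, h⟩).ne' ?_
  have := enorm_ae_le_eLpNormEssSup g volume
  rw [ae_iff] at this
  simpa using this

/-- For `p = ∞` continuity turns the essential supremum into a supremum, which is lower
semicontinuous in `y`; for finite `p` Tonelli applies. -/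
theorem measurable_eLpNorm_of_continuous {Φ : Y → 𝔼 → ℂ} (hΦ : Continuous (Function.uncurry Φ))
    {p : ℝ≥0∞} (hp : 1 ≤ p) : Measurable fun y => eLpNorm (Φ y) p volume := by
  have hΦy : ∀ y, Continuous (Φ y) := fun y => hΦ.comp (.prodMk_right y)
  rcases eq_or_ne p ∞ with rfl | hp'
  · have h : (fun y => eLpNorm (Φ y) ∞ volume) = fun y => ⨆ t, ‖Φ y t‖ₑ := by
      ext y
      refine le_antisymm ?_ (iSup_le fun t => enorm_le_eLpNorm_top (hΦy y) t)
      rw [eLpNorm_exponent_top]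
      exact essSup_le_of_ae_le _ (.of_forall fun t => le_iSup (fun t => ‖Φ y t‖ₑ) t)
    rw [h]
    refine LowerSemicontinuous.measurable (lowerSemicontinuous_iSup fun t => ?_)
    exact (hΦ.comp (.prodMk_left t)).enorm.lowerSemicontinuous
  · simp_rw [eLpNorm_eq_lintegral_rpow_enorm_toReal (zero_lt_one.trans_le hp).ne' hp']
    refine Measurable.pow_const ?_ _
    exact Measurable.lintegral_prod_right' (f := fun z : Y × 𝔼 => ‖Φ z.1 z.2‖ₑ ^ p.toReal)
      (hΦ.measurable.enorm.pow_const _)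

/-- Minkowski's inequality over the product of `ν` and Lebesgue measure in `z`: a shift by `z`
leaves the `L^p` norm unchanged, so only the `L^1` norm of `w` enters, whatever `p` is. -/
theorem eLpNorm_le_of_enorm_le_convolution {ν : Measure Y} [SFinite ν] {Φ : Y → 𝔼 → ℂ}
    (hΦ : Continuous (Function.uncurry Φ)) {Ψ : 𝔼 → ℂ} {K : Y → ℝ≥0∞} (hK : Measurable K)
    {w : 𝔼 → ℝ≥0∞} (hw : Measurable w)
    (h : ∀ t, ‖Ψ t‖ₑ ≤ ∫⁻ y, K y * (∫⁻ z, w z * ‖Φ y (t + z)‖ₑ) ∂ν) {p : ℝ≥0∞} (hp : 1 ≤ p) :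
    eLpNorm Ψ p volume ≤ (∫⁻ z, w z) * ∫⁻ y, K y * eLpNorm (Φ y) p volume ∂ν := by
  have hΦy : ∀ y, Continuous (Φ y) := fun y => hΦ.comp (.prodMk_right y)
  have hN := measurable_eLpNorm_of_continuous hΦ hp
  have hprod : (∫⁻ z, w z) * ∫⁻ y, K y * eLpNorm (Φ y) p volume ∂ν =
      ∫⁻ y, K y * (∫⁻ z, w z * eLpNorm (Φ y) p volume) ∂ν := by
    have hm : Measurable fun y => K y * eLpNorm (Φ y) p volume := hK.mul hN
    rw [← lintegral_const_mul _ hm]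
    refine lintegral_congr fun y => ?_
    rw [lintegral_mul_const _ hw]
    ring
  rw [hprod]
  rcases eq_or_ne p ∞ with rfl | hp'
  · rw [eLpNorm_exponent_top (f := Ψ)]
    refine essSup_le_of_ae_le _ (.of_forall fun t => (h t).trans ?_)
    refine lintegral_mono fun y => ?_
    gcongr with z
    exact enorm_le_eLpNorm_top (hΦy y) _
  · have hp0 := (zero_lt_one.trans_le hp).ne'
    set r := p.toReal with hr_def
    have hr : 1 ≤ r := by
      rw [← ENNReal.toReal_one]
      exact ENNReal.toReal_mono hp' hp
    have hr0 : 0 < r := by linarith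
    have hΦm : Measurable fun z : 𝔼 × (Y × 𝔼) => ‖Φ z.2.1 (z.1 + z.2.2)‖ₑ :=
      (hΦ.comp (f := fun z : 𝔼 × (Y × 𝔼) => (z.2.1, z.1 + z.2.2)) (by fun_prop)).measurable.enorm
    have hKw : Measurable fun z : Y × 𝔼 => K z.1 * w z.2 :=
      (hK.comp measurable_fst).mul (hw.comp measurable_snd)
    have hH : Measurable (Function.uncurry fun (t : 𝔼) (z : Y × 𝔼) =>
        K z.1 * w z.2 * ‖Φ z.1 (t + z.2)‖ₑ) := (hKw.comp measurable_snd).mul hΦm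
    rw [eLpNorm_eq_lintegral_rpow_enorm_toReal hp0 hp']
    calc (∫⁻ t, ‖Ψ t‖ₑ ^ r) ^ (1 / r)
        ≤ (∫⁻ t, (∫⁻ z, K z.1 * w z.2 * ‖Φ z.1 (t + z.2)‖ₑ ∂(ν.prod volume)) ^ r) ^ (1 / r) := by
          gcongr with t
          refine (h t).trans (le_of_eq ?_)
          have hHt : Measurable fun z : Y × 𝔼 => K z.1 * w z.2 * ‖Φ z.1 (t + z.2)‖ₑ :=
            hH.comp (measurable_const.prodMk measurable_id)
          rw [lintegral_prod _ hHt.aemeasurable]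
          refine lintegral_congr fun y => ?_
          have hm : Measurable fun z : 𝔼 => w z * ‖Φ y (t + z)‖ₑ :=
            hw.mul ((hΦy y).comp (continuous_const.add continuous_id)).measurable.enorm
          rw [← lintegral_const_mul _ hm]
          refine lintegral_congr fun z => ?_
          ring
      _ ≤ ∫⁻ z, (∫⁻ t, (K z.1 * w z.2 * ‖Φ z.1 (t + z.2)‖ₑ) ^ r) ^ (1 / r) ∂(ν.prod volume) :=
          lintegral_rpow_lintegral_le hH hr
      _ = ∫⁻ z, K z.1 * w z.2 * eLpNorm (Φ z.1) p volume ∂(ν.prod volume) := by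
          refine lintegral_congr fun z => ?_
          have hm : Measurable fun t : 𝔼 => ‖Φ z.1 (t + z.2)‖ₑ ^ r :=
            (((hΦy z.1).comp (continuous_id.add continuous_const)).measurable.enorm).pow_const r
          simp_rw [ENNReal.mul_rpow_of_nonneg _ _ hr0.le]
          rw [lintegral_const_mul _ hm, lintegral_add_right_eq_self (fun t => ‖Φ z.1 t‖ₑ ^ r) z.2,
            ← ENNReal.mul_rpow_of_nonneg _ _ hr0.le,
            ENNReal.mul_rpow_of_nonneg _ _ (by positivity : 0 ≤ 1 / r), ← ENNReal.rpow_mul,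
            mul_one_div_cancel hr0.ne', ENNReal.rpow_one,
            eLpNorm_eq_lintegral_rpow_enorm_toReal hp0 hp']
      _ = _ := by
          have hm : Measurable fun z : Y × 𝔼 => K z.1 * w z.2 * eLpNorm (Φ z.1) p volume :=
            hKw.mul (hN.comp measurable_fst)
          rw [lintegral_prod _ hm.aemeasurable]
          refine lintegral_congr fun y => ?_
          rw [← lintegral_const_mul _ (hw.mul_const _)]
          refine lintegral_congr fun z => ?_
          ring

/-- The integrable kernel `v ↦ (1 + ‖v‖) ^ {-(n+1)}`. -/
def decayKernel (v : 𝔼) : ℝ≥0∞ := ENNReal.ofReal ((1 + ‖v‖) ^ (n + 1))⁻¹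

theorem continuous_decayKernel : Continuous (decayKernel (n := n)) := by
  refine ENNReal.continuous_ofReal.comp (Continuous.inv₀ (by fun_prop) fun v => ?_)
  positivity

theorem decayKernel_neg (v : 𝔼) : decayKernel (-v) = decayKernel v := by
  simp [decayKernel]

theorem lintegral_decayKernel_ne_top : ∫⁻ v : 𝔼, decayKernel v ≠ ∞ := by
  have h := (integrable_one_add_norm_pow_inv (n := n) (N := n + 1) n.lt_add_one).lintegral_lt_top
  exact h.ne

/-- A family of points `ι y` of `ℝⁿ`, over a measure space, of bounded density. -/
structure HasBoundedDensity (μ : Measure Y) (ι : Y → 𝔼) : Prop where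
  continuous : Continuous ι
  exists_bound : ∃ A : ℝ≥0, ∀ z, ∫⁻ y, decayKernel (z - ι y) ∂μ ≤ A

theorem hasBoundedDensity_id : HasBoundedDensity (volume : Measure 𝔼) id where
  continuous := continuous_id
  exists_bound := by
    refine ⟨(∫⁻ v : 𝔼, decayKernel v).toNNReal, fun z => ?_⟩
    rw [ENNReal.coe_toNNReal lintegral_decayKernel_ne_top]
    exact (lintegral_sub_left_eq_self (fun v : 𝔼 => decayKernel v) z).le

theorem one_le_norm_latticePoint_sub {k l : Fin n → ℤ} (h : k ≠ l) :
    1 ≤ ‖latticePoint k - latticePoint l‖ := by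
  obtain ⟨i, hi⟩ := Function.ne_iff.1 h
  refine le_trans ?_ (PiLp.norm_apply_le (latticePoint k - latticePoint l) i)
  have : (latticePoint k - latticePoint l) i = ((k i - l i : ℤ) : ℝ) := by simp [latticePoint]
  rw [this, Real.norm_eq_abs, ← Int.cast_abs]
  exact_mod_cast Int.one_le_abs (sub_ne_zero.2 hi)

/-- The balls of radius `1/2` around lattice points are disjoint, and on each of them the kernel
varies by a factor of at most `2 ^ (n + 1)`; the lattice sum is therefore bounded by an integral. -/
theorem hasBoundedDensity_latticePoint :
    HasBoundedDensity (Measure.count : Measure (Fin n → ℤ)) (latticePoint (n := n)) where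
  continuous := continuous_of_discreteTopology
  exists_bound := by
    set v := volume (Metric.ball (0 : 𝔼) (1 / 2)) with hv
    have hv0 : v ≠ 0 := (Metric.measure_ball_pos _ _ (by norm_num)).ne'
    have hvt : v ≠ ∞ := measure_ball_lt_top.ne
    set B := ENNReal.ofReal (2 ^ (n + 1)) * ∫⁻ η : 𝔼, decayKernel η with hB
    have hBt : B / v ≠ ∞ :=
      (ENNReal.div_lt_top (ENNReal.mul_ne_top (by simp) lintegral_decayKernel_ne_top) hv0).ne
    refine ⟨(B / v).toNNReal, fun z => ?_⟩
    rw [ENNReal.coe_toNNReal hBt, lintegral_count, ENNReal.le_div_iff_mul_le (.inl hv0) (.inl hvt),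
      ← ENNReal.tsum_mul_right]
    have hpt : ∀ k : Fin n → ℤ, decayKernel (z - latticePoint k) * v ≤
        ∫⁻ η in Metric.ball (latticePoint k) (1 / 2),
          ENNReal.ofReal (2 ^ (n + 1)) * decayKernel (z - η) := fun k => by
      have hvk : v = volume (Metric.ball (latticePoint k : 𝔼) (1 / 2)) := by
        rw [hv, Measure.addHaar_ball_center volume (latticePoint k)]
      rw [hvk, ← setLIntegral_const]
      refine setLIntegral_mono ?_ fun η hη => ?_
      · exact ((continuous_decayKernel.comp (continuous_const.sub continuous_id)).measurable).const_mul _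
      · rw [decayKernel, decayKernel, ← ENNReal.ofReal_mul (by positivity)]
        refine ENNReal.ofReal_le_ofReal ?_
        rw [← div_eq_mul_inv, le_div_iff₀ (by positivity), inv_mul_le_iff₀ (by positivity),
          ← mul_pow]
        refine pow_le_pow_left₀ (by positivity) ?_ _
        have h1 : ‖η - latticePoint k‖ < 1 / 2 := by simpa [dist_eq_norm] using hη
        have h2 : ‖z - η‖ ≤ ‖z - latticePoint k‖ + ‖η - latticePoint k‖ := by
          have := norm_sub_le (z - latticePoint k) (η - latticePoint k)
          rwa [sub_sub_sub_cancel_right] at this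
        linarith [norm_nonneg (z - latticePoint k)]
    have hdisj : Pairwise (Function.onFun Disjoint fun k : Fin n → ℤ =>
        Metric.ball (latticePoint k : 𝔼) (1 / 2)) := fun k l hkl =>
      Metric.ball_disjoint_ball (by
        have := one_le_norm_latticePoint_sub hkl
        rw [dist_eq_norm]
        linarith)
    calc ∑' k : Fin n → ℤ, decayKernel (z - latticePoint k) * v
        ≤ ∑' k : Fin n → ℤ, ∫⁻ η in Metric.ball (latticePoint k) (1 / 2),
          ENNReal.ofReal (2 ^ (n + 1)) * decayKernel (z - η) := ENNReal.tsum_le_tsum hpt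
      _ = ∫⁻ η in ⋃ k : Fin n → ℤ, Metric.ball (latticePoint k) (1 / 2),
          ENNReal.ofReal (2 ^ (n + 1)) * decayKernel (z - η) :=
          (lintegral_iUnion (fun k => measurableSet_ball) hdisj _).symm
      _ ≤ ∫⁻ η : 𝔼, ENNReal.ofReal (2 ^ (n + 1)) * decayKernel (z - η) :=
          setLIntegral_le_lintegral _ _
      _ = B := by
          have hm : Measurable fun η : 𝔼 => decayKernel (z - η) :=
            (continuous_decayKernel.comp (continuous_const.sub continuous_id)).measurable
          rw [lintegral_const_mul _ hm, lintegral_sub_left_eq_self (fun v : 𝔼 => decayKernel v) z]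

theorem bracket_pos (s : ℝ) (ξ : 𝔼) : 0 < bracket s ξ := by
  unfold bracket
  positivity

theorem continuous_bracket (s : ℝ) : Continuous (bracket (n := n) s) := by
  unfold bracket
  exact Continuous.rpow_const (by fun_prop) fun ξ => .inl (by positivity)

/-- **Peetre's inequality**. -/
theorem exists_bracket_le (s : ℝ) : ∃ (C : ℝ) (M : ℕ), 0 ≤ C ∧ ∀ ξ η : 𝔼,
    bracket s ξ ≤ C * (1 + ‖ξ - η‖) ^ M * bracket s η := by
  have hP : ∀ ξ η : 𝔼, 1 + ‖ξ‖ ^ 2 ≤ 2 * (1 + ‖ξ - η‖) ^ 2 * (1 + ‖η‖ ^ 2) := fun ξ η => by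
    have h1 : ‖ξ‖ ≤ ‖η‖ + ‖ξ - η‖ := by
      have := norm_le_norm_add_norm_sub' ξ η
      linarith
    have h2 := norm_nonneg η
    have h3 := norm_nonneg (ξ - η)
    have h4 : ‖ξ‖ ^ 2 ≤ (‖η‖ + ‖ξ - η‖) ^ 2 := by gcongr
    nlinarith [sq_nonneg (‖η‖ - ‖ξ - η‖), mul_nonneg h3 (sq_nonneg ‖η‖),
      mul_nonneg (sq_nonneg ‖ξ - η‖) (sq_nonneg ‖η‖)]
  have hpow : ∀ (t : ℝ), 0 ≤ t → ∀ ξ η : 𝔼, (1 + ‖ξ‖ ^ 2) ^ t ≤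
      (2 ^ t * (1 + ‖ξ - η‖) ^ (2 * ⌈t⌉₊)) * (1 + ‖η‖ ^ 2) ^ t := fun t ht ξ η => by
    calc (1 + ‖ξ‖ ^ 2) ^ t ≤ (2 * (1 + ‖ξ - η‖) ^ 2 * (1 + ‖η‖ ^ 2)) ^ t :=
          Real.rpow_le_rpow (by positivity) (hP ξ η) ht
      _ = (2 ^ t * ((1 + ‖ξ - η‖) ^ 2) ^ t) * (1 + ‖η‖ ^ 2) ^ t := by
          rw [Real.mul_rpow (by positivity) (by positivity),
            Real.mul_rpow (by positivity) (by positivity)]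
      _ ≤ _ := by
          have h1 : (1 : ℝ) ≤ (1 + ‖ξ - η‖) ^ 2 := one_le_pow₀ (by linarith [norm_nonneg (ξ - η)])
          have h2 : ((1 + ‖ξ - η‖) ^ 2) ^ t ≤ (1 + ‖ξ - η‖) ^ (2 * ⌈t⌉₊) := by
            rw [pow_mul, ← Real.rpow_natCast _ ⌈t⌉₊]
            exact Real.rpow_le_rpow_of_exponent_le h1 (Nat.le_ceil t)
          gcongr
  rcases le_total 0 s with hs | hs
  · exact ⟨2 ^ (s / 2), 2 * ⌈s / 2⌉₊, by positivity, fun ξ η => hpow (s / 2) (by linarith) ξ η⟩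
  -- For negative `s`, the inequality for the exponent `-s / 2` with `ξ` and `η` exchanged is
  -- inverted.
  · refine ⟨2 ^ (-s / 2), 2 * ⌈-s / 2⌉₊, by positivity, fun ξ η => ?_⟩
    have h := hpow (-s / 2) (by linarith) η ξ
    have hneg : ∀ ξ : 𝔼, bracket s ξ = ((1 + ‖ξ‖ ^ 2) ^ (-s / 2))⁻¹ := fun ξ => by
      rw [bracket, ← Real.rpow_neg (by positivity)]
      congr 1
      ring
    rw [hneg, hneg, ← div_eq_mul_inv, le_div_iff₀ (by positivity), inv_mul_le_iff₀ (by positivity),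
      mul_comm, norm_sub_rev ξ η]
    exact h

end MixedNorm

/-! ### Comparison of the mixed norms of two families of coefficients -/

section Comparison

variable {n : ℕ}

local notation "𝔼" => EuclideanSpace ℝ (Fin n)

/-- The function `t ↦ U (e ^ {i t·} d(· - ξ))`. -/
def coeff (U : 𝓢(𝔼, ℂ) →L[ℂ] ℂ) (d : 𝓢(𝔼, ℂ)) (ξ t : 𝔼) : ℂ := U (modulate t (translate ξ d))

theorem continuous_translate_left (d : 𝓢(𝔼, ℂ)) : Continuous fun ξ : 𝔼 => translate ξ d := by
  have h := (continuous_translate (E := 𝔼)).comp (f := fun y : 𝔼 => (y, d)) (by fun_prop)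
  simpa only [Function.comp_def] using h

theorem continuous_coeff (U : 𝓢(𝔼, ℂ) →L[ℂ] ℂ) (d : 𝓢(𝔼, ℂ)) :
    Continuous (Function.uncurry (coeff U d)) := by
  have h := U.continuous.comp ((continuous_modulate (n := n)).comp
    (f := fun z : 𝔼 × 𝔼 => (z.2, translate z.1 d))
    (continuous_snd.prodMk ((continuous_translate_left d).comp continuous_fst)))
  exact h

theorem continuous_coeff_comp {Y : Type*} [TopologicalSpace Y] {ι : Y → EuclideanSpace ℝ (Fin n)}
    (U : 𝓢(𝔼, ℂ) →L[ℂ] ℂ) (d : 𝓢(𝔼, ℂ)) (hι : Continuous ι) :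
    Continuous (Function.uncurry fun y => coeff U d (ι y)) := by
  have h := (continuous_coeff U d).comp (f := fun z : Y × 𝔼 => (ι z.1, z.2))
    ((hι.comp continuous_fst).prodMk continuous_snd)
  exact h

theorem mulS_comm (g h : 𝓢(𝔼, ℂ)) : mulS g h = mulS h g := by
  ext x
  rw [mulS_apply, mulS_apply, mul_comm]

theorem norm_fourierS_translate (a : 𝔼) (u : 𝓢(𝔼, ℂ)) (z : 𝔼) :
    ‖fourierS n (translate a u) z‖ = ‖fourierS n u z‖ := by
  have h : fourierS n (translate a u) z = character z a * fourierS n u z := by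
    rw [fourierS_apply, fourierS_apply]
    simp_rw [translate_apply]
    rw [← integral_add_right_eq_self (μ := volume) (fun ξ => u (ξ - a) *
      Complex.exp (-Complex.I * (inner ℝ ξ z : ℝ))) a, mul_left_comm]
    congr 1
    rw [← integral_const_mul]
    congr 1
    ext ξ
    rw [add_sub_cancel_right, inner_add_left, Complex.ofReal_add, mul_add, Complex.exp_add,
      character]
    ring
  rw [h, norm_mul, norm_character, one_mul]

/-- A common translation changes the transform by a unimodular factor, so only `x - y` matters. The
product of two Schwartz functions with distant centres is small in every seminorm, and this survives
the continuous operator `𝓕`. The seminorms of weight `0` and `n + 1` together give the decay in `z`.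
-/
theorem exists_norm_fourierS_mulS_le (a b : 𝓢(𝔼, ℂ)) (M : ℕ) : ∃ C : ℝ, 0 ≤ C ∧ ∀ x y z : 𝔼,
    ‖fourierS n (mulS (translate x a) (translate y b)) z‖ ≤
      C * ((1 + ‖x - y‖) ^ M)⁻¹ * ((1 + ‖z‖) ^ (n + 1))⁻¹ := by
  obtain ⟨C₀, h0, hC₀⟩ := exists_mulS_translate_le a b M (fourierS n) 0 0
  obtain ⟨C₁, h1, hC₁⟩ := exists_mulS_translate_le a b M (fourierS n) (n + 1) 0
  refine ⟨2 ^ (n + 1) * (C₀ + C₁), by positivity, fun x y z => ?_⟩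
  have htr : mulS (translate x a) (translate y b) =
      translate y (mulS (translate (x - y) a) b) := by
    ext η
    simp only [mulS_apply, translate_apply]
    congr 2
    abel
  rw [htr, norm_fourierS_translate]
  set v := fourierS n (mulS (translate (x - y) a) b) with hv
  have hz : (1 + ‖z‖) ^ (n + 1) ≤ 2 ^ (n + 1) * (1 + ‖z‖ ^ (n + 1)) := by
    calc (1 + ‖z‖) ^ (n + 1) ≤ (2 * max 1 ‖z‖) ^ (n + 1) := by
          gcongr
          linarith [le_max_left 1 ‖z‖, le_max_right 1 ‖z‖]
      _ = 2 ^ (n + 1) * (max 1 ‖z‖) ^ (n + 1) := mul_pow _ _ _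
      _ ≤ _ := by
          gcongr
          rcases max_choice 1 ‖z‖ with h | h <;> rw [h]
          · rw [one_pow]
            linarith [pow_nonneg (norm_nonneg z) (n + 1)]
          · linarith
  have e0 := SchwartzMap.norm_le_seminorm ℂ v z
  have e1 := SchwartzMap.norm_pow_mul_le_seminorm ℂ v (n + 1) z
  rw [← div_eq_mul_inv, ← div_eq_mul_inv, le_div_iff₀ (by positivity), le_div_iff₀ (by positivity)]
  have f0 := hC₀ (x - y)
  have f1 := hC₁ (x - y)
  rw [← hv] at f0 f1
  calc ‖v z‖ * (1 + ‖z‖) ^ (n + 1) * (1 + ‖x - y‖) ^ M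
      ≤ ‖v z‖ * (2 ^ (n + 1) * (1 + ‖z‖ ^ (n + 1))) * (1 + ‖x - y‖) ^ M := by gcongr
    _ = 2 ^ (n + 1) * ((1 + ‖x - y‖) ^ M * ‖v z‖ +
        (1 + ‖x - y‖) ^ M * (‖z‖ ^ (n + 1) * ‖v z‖)) := by ring
    _ ≤ 2 ^ (n + 1) * ((1 + ‖x - y‖) ^ M * SchwartzMap.seminorm ℂ 0 0 v +
        (1 + ‖x - y‖) ^ M * SchwartzMap.seminorm ℂ (n + 1) 0 v) := by gcongr
    _ ≤ _ := by gcongr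

variable {Y : Type*} [TopologicalSpace Y] [MeasurableSpace Y] [OpensMeasurableSpace Y]
  {μ : Measure Y} {ι : Y → EuclideanSpace ℝ (Fin n)}

theorem HasBoundedDensity.integrable (hι : HasBoundedDensity μ ι) :
    Integrable (fun y => ((1 + ‖ι y‖) ^ (n + 1))⁻¹) μ := by
  obtain ⟨A, hA⟩ := hι.exists_bound
  have hc : Continuous fun y => ((1 + ‖ι y‖) ^ (n + 1))⁻¹ := by
    have := hι.continuous
    refine Continuous.inv₀ (by fun_prop) fun y => ?_
    positivity
  refine ⟨hc.aestronglyMeasurable, ?_⟩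
  rw [hasFiniteIntegral_iff_ofReal (.of_forall fun y => by positivity)]
  refine lt_of_le_of_lt ?_ (ENNReal.coe_lt_top (r := A))
  simpa [decayKernel] using hA 0

variable [SecondCountableTopology Y]

/-- A resolution of the identity by translates of `g` acts on tempered distributions. -/
theorem HasBoundedDensity.mul_apply_eq_integral (hι : HasBoundedDensity μ ι)
    (U : 𝓢(𝔼, ℂ) →L[ℂ] ℂ) {g : 𝓢(𝔼, ℂ)} {A : ℂ} (hg : ∀ η, ∫ y, g (η - ι y) ∂μ = A)
    (m : 𝓢(𝔼, ℂ)) : A * U m = ∫ y, U (mulS (translate (ι y) g) m) ∂μ := by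
  have hw : Continuous fun y => mulS (translate (ι y) g) m := by
    -- Multiplication by the fixed `m` is a continuous operator, so only the translate has to vary
    -- continuously.
    simp_rw [mulS_comm _ m]
    exact (SchwartzMap.smulLeftCLM ℂ m).continuous.comp
      ((continuous_translate_left g).comp hι.continuous)
  have hint : ∀ k l, Integrable
      (fun y => SchwartzMap.seminorm ℂ k l (mulS (translate (ι y) g) m)) μ := fun k l => by
    obtain ⟨C, hC0, hC⟩ := exists_seminorm_mulS_translate_le g m (n + 1) k l
    refine (hι.integrable.const_mul C).mono' (Continuous.aestronglyMeasurable
      (((schwartz_withSeminorms ℂ 𝔼 ℂ).continuous_seminorm (k, l)).comp hw))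
      (.of_forall fun y => ?_)
    rw [Real.norm_of_nonneg (apply_nonneg _ _), ← div_eq_mul_inv, le_div_iff₀' (by positivity)]
    exact hC (ι y)
  have hW : ∀ η, (A • m) η = ∫ y, mulS (translate (ι y) g) m η ∂μ := fun η => by
    simp_rw [mulS_apply, translate_apply]
    rw [integral_mul_const, hg, smul_apply, smul_eq_mul]
  have h := (integrable_and_eq_integral U hw hint hW).2
  rwa [map_smul, smul_eq_mul] at h

/-- The resolution of the identity is inserted, and the product is regrouped so that `a` and `b`
form the convolution kernel while `d` remains in the coefficient. -/
theorem HasBoundedDensity.enorm_coeff_le (hι : HasBoundedDensity μ ι)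
    (U : 𝓢(𝔼, ℂ) →L[ℂ] ℂ) (a : 𝓢(𝔼, ℂ)) {b d : 𝓢(𝔼, ℂ)} {A : ℂ}
    (hbd : ∀ η, ∫ y, b (η - ι y) * d (η - ι y) ∂μ = A) (x t : 𝔼) :
    ‖A‖ₑ * ‖coeff U a x t‖ₑ ≤ ∫⁻ y, ‖normFactor n‖ₑ * (∫⁻ z,
      ‖fourierS n (mulS (translate x a) (translate (ι y) b)) z‖ₑ *
        ‖coeff U d (ι y) (t + z)‖ₑ) ∂μ := by
  have h := hι.mul_apply_eq_integral U (g := mulS b d) (A := A)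
    (fun η => by simpa only [mulS_apply] using hbd η) (modulate t (translate x a))
  rw [coeff, ← enorm_mul, h]
  refine (enorm_integral_le_lintegral_enorm _).trans (lintegral_mono fun y => ?_)
  have h1 : mulS (translate (ι y) (mulS b d)) (modulate t (translate x a)) =
      modulate t (mulS (mulS (translate x a) (translate (ι y) b)) (translate (ι y) d)) := by
    ext η
    simp only [mulS_apply, translate_apply, modulate_apply]
    ring
  simp only [h1]
  exact enorm_apply_modulate_mulS_le U _ _ t

/-- The `L^p` norms of the coefficients for `a` are dominated by superpositions of those of the
coefficients for `d`. -/
theorem HasBoundedDensity.exists_eLpNorm_coeff_le [SFinite μ] (hι : HasBoundedDensity μ ι)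
    (a b d : 𝓢(𝔼, ℂ)) {A : ℂ} (hA : A ≠ 0)
    (hbd : ∀ η, ∫ y, b (η - ι y) * d (η - ι y) ∂μ = A) (M : ℕ) :
    ∃ C : ℝ≥0, ∀ (U : 𝓢(𝔼, ℂ) →L[ℂ] ℂ) (p : ℝ≥0∞), 1 ≤ p → ∀ x : 𝔼,
      eLpNorm (coeff U a x) p volume ≤ C * ∫⁻ y, ENNReal.ofReal ((1 + ‖x - ι y‖) ^ M)⁻¹ *
        eLpNorm (coeff U d (ι y)) p volume ∂μ := by
  obtain ⟨C, hC, hdec⟩ := exists_norm_fourierS_mulS_le a b M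
  set W : ℝ≥0∞ := ∫⁻ z : 𝔼, decayKernel z with hW
  have hWt : W ≠ ∞ := lintegral_decayKernel_ne_top
  set D : ℝ≥0∞ := ‖A‖ₑ⁻¹ * ‖normFactor n‖ₑ * ENNReal.ofReal C with hD
  have hA0 : ‖A‖ₑ ≠ 0 := by simpa using hA
  have hDt : D ≠ ∞ := ENNReal.mul_ne_top
    (ENNReal.mul_ne_top (ENNReal.inv_ne_top.2 hA0) enorm_ne_top) ENNReal.ofReal_ne_top
  refine ⟨(W * D).toNNReal, fun U p hp x => ?_⟩
  rw [ENNReal.coe_toNNReal (ENNReal.mul_ne_top hWt hDt)]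
  have hΦ := continuous_coeff_comp U d hι.continuous
  have hdk := (continuous_decayKernel (n := n)).measurable
  have hkm : Measurable fun y => D * ENNReal.ofReal ((1 + ‖x - ι y‖) ^ M)⁻¹ := by
    refine (Measurable.ennreal_ofReal (Continuous.measurable ?_)).const_mul D
    have := hι.continuous
    refine Continuous.inv₀ (by fun_prop) fun y => ?_
    positivity
  have hpt : ∀ t, ‖coeff U a x t‖ₑ ≤ ∫⁻ y, D * ENNReal.ofReal ((1 + ‖x - ι y‖) ^ M)⁻¹ *
      (∫⁻ z, decayKernel z * ‖coeff U d (ι y) (t + z)‖ₑ) ∂μ := by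
    intro t
    calc ‖coeff U a x t‖ₑ = ‖A‖ₑ⁻¹ * (‖A‖ₑ * ‖coeff U a x t‖ₑ) := by
          rw [← mul_assoc, ENNReal.inv_mul_cancel hA0 enorm_ne_top, one_mul]
      _ ≤ ‖A‖ₑ⁻¹ * ∫⁻ y, ‖normFactor n‖ₑ * (∫⁻ z,
          ‖fourierS n (mulS (translate x a) (translate (ι y) b)) z‖ₑ *
            ‖coeff U d (ι y) (t + z)‖ₑ) ∂μ :=
          mul_le_mul_right (hι.enorm_coeff_le U a hbd x t) _
      _ = ∫⁻ y, ‖A‖ₑ⁻¹ * (‖normFactor n‖ₑ * (∫⁻ z,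
          ‖fourierS n (mulS (translate x a) (translate (ι y) b)) z‖ₑ *
            ‖coeff U d (ι y) (t + z)‖ₑ)) ∂μ :=
          (lintegral_const_mul' _ _ (ENNReal.inv_ne_top.2 hA0)).symm
      _ ≤ _ := by
          refine lintegral_mono fun y => ?_
          have hcc : Continuous fun z => coeff U d (ι y) (t + z) :=
            hΦ.comp (f := fun z => (y, t + z)) (by fun_prop)
          have hm : Measurable fun z => decayKernel z * ‖coeff U d (ι y) (t + z)‖ₑ :=
            hdk.mul hcc.measurable.enorm
          simp only
          rw [hD, mul_assoc _ (ENNReal.ofReal C), mul_assoc, mul_assoc]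
          refine mul_le_mul_right (mul_le_mul_right ?_ _) _
          rw [← ENNReal.ofReal_mul hC, ← lintegral_const_mul _ hm]
          refine lintegral_mono fun z => ?_
          simp only
          rw [← mul_assoc, decayKernel, ← ENNReal.ofReal_mul (by positivity), ← ofReal_norm]
          exact mul_le_mul_left (ENNReal.ofReal_le_ofReal (hdec _ _ _)) _
  refine (eLpNorm_le_of_enorm_le_convolution hΦ hkm hdk hpt hp).trans (le_of_eq ?_)
  rw [← hW, mul_assoc, ← lintegral_const_mul' _ _ hDt]
  simp_rw [mul_assoc]

/-- If translates of `b d` along `ι` resolve the identity, the mixed norm of the coefficients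
for `a` along `κ` is dominated by that of the coefficients for `d` along `ι`. -/
theorem exists_eLpNorm_eLpNorm_coeff_le {X : Type*} [TopologicalSpace X] [MeasurableSpace X]
    [OpensMeasurableSpace X] {ν : Measure X} [SFinite ν] [SFinite μ] {κ : X → 𝔼}
    (hκ : HasBoundedDensity ν κ) (hι : HasBoundedDensity μ ι) (a b d : 𝓢(𝔼, ℂ)) {A : ℂ}
    (hA : A ≠ 0) (hbd : ∀ η, ∫ y, b (η - ι y) * d (η - ι y) ∂μ = A) (s : ℝ) :
    ∃ C : ℝ≥0, ∀ (U : 𝓢(𝔼, ℂ) →L[ℂ] ℂ) (p q : ℝ≥0∞), 1 ≤ p → 1 ≤ q →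
      eLpNorm (fun x => ENNReal.ofReal (bracket s (κ x)) * eLpNorm (coeff U a (κ x)) p volume) q ν ≤
        C * eLpNorm (fun y => ENNReal.ofReal (bracket s (ι y)) *
          eLpNorm (coeff U d (ι y)) p volume) q μ := by
  obtain ⟨B, M, hB, hbr⟩ := exists_bracket_le (n := n) s
  -- Of this decay, `M` powers absorb the loss in Peetre's inequality and `n + 1` remain as
  -- `decayKernel` for Schur's test.
  obtain ⟨C, hC⟩ := hι.exists_eLpNorm_coeff_le a b d hA hbd (M + (n + 1))
  obtain ⟨A₁, hA₁⟩ := hκ.exists_bound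
  obtain ⟨A₂, hA₂⟩ := hι.exists_bound
  set D : ℝ≥0∞ := C * ENNReal.ofReal B with hD
  have hDt : D ≠ ∞ := ENNReal.mul_ne_top ENNReal.coe_ne_top ENNReal.ofReal_ne_top
  -- Schur's test takes one bound for rows and columns: `A₂` bounds the integrals over `y`, `A₁`
  -- those over `x`.
  refine ⟨(D * (A₁ + A₂)).toNNReal, fun U p q hp hq => ?_⟩
  rw [ENNReal.coe_toNNReal (ENNReal.mul_ne_top hDt (by simp))]
  have hΦ := continuous_coeff_comp U d hι.continuous
  have hN := measurable_eLpNorm_of_continuous hΦ hp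
  have hdk := (continuous_decayKernel (n := n)).measurable
  have hK : Measurable (Function.uncurry fun (x : X) (y : Y) => D * decayKernel (κ x - ι y)) :=
    (hdk.comp ((hκ.continuous.measurable.comp measurable_fst).sub
      (hι.continuous.measurable.comp measurable_snd))).const_mul D
  have hF : Measurable fun y => ENNReal.ofReal (bracket s (ι y)) *
      eLpNorm (coeff U d (ι y)) p volume :=
    (((continuous_bracket s).comp hι.continuous).measurable.ennreal_ofReal).mul hN
  have hpt : ∀ x, ENNReal.ofReal (bracket s (κ x)) * eLpNorm (coeff U a (κ x)) p volume ≤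
      ∫⁻ y, D * decayKernel (κ x - ι y) * (ENNReal.ofReal (bracket s (ι y)) *
        eLpNorm (coeff U d (ι y)) p volume) ∂μ := fun x => by
    refine (mul_le_mul_right (hC U p hp (κ x)) _).trans ?_
    rw [mul_left_comm, ← lintegral_const_mul' _ _ ENNReal.ofReal_ne_top,
      ← lintegral_const_mul' _ _ ENNReal.coe_ne_top]
    refine lintegral_mono fun y => ?_
    simp only
    rw [hD, mul_assoc, mul_assoc]
    refine mul_le_mul_right ?_ _
    rw [← mul_assoc, ← mul_assoc, ← mul_assoc, decayKernel,
      ← ENNReal.ofReal_mul (bracket_pos _ _).le, ← ENNReal.ofReal_mul hB,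
      ← ENNReal.ofReal_mul (by positivity)]
    refine mul_le_mul_left (ENNReal.ofReal_le_ofReal ?_) _
    calc bracket s (κ x) * ((1 + ‖κ x - ι y‖) ^ (M + (n + 1)))⁻¹
        ≤ (B * (1 + ‖κ x - ι y‖) ^ M * bracket s (ι y)) *
          ((1 + ‖κ x - ι y‖) ^ (M + (n + 1)))⁻¹ :=
          mul_le_mul_of_nonneg_right (hbr _ _) (by positivity)
      _ = _ := by
          rw [pow_add]
          field_simp
  refine le_trans (eLpNorm_mono_enorm fun x => ?_) (eLpNorm_lintegral_kernel_le hK hF ?_ ?_ hq)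
  · simpa only [enorm_eq_self] using hpt x
  · intro x
    have hm : Measurable fun y => decayKernel (κ x - ι y) :=
      hdk.comp (measurable_const.sub hι.continuous.measurable)
    rw [lintegral_const_mul _ hm]
    exact mul_le_mul_right ((hA₂ (κ x)).trans le_add_self) _
  · intro y
    have hm : Measurable fun x => decayKernel (κ x - ι y) :=
      hdk.comp (hκ.continuous.measurable.sub measurable_const)
    rw [lintegral_const_mul _ hm]
    refine mul_le_mul_right (le_trans (le_of_eq ?_) ((hA₁ (ι y)).trans le_self_add)) _
    refine lintegral_congr fun x => ?_
    rw [← decayKernel_neg, neg_sub]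

end Comparison

/-! ### The two modulation norms as mixed norms of coefficients -/

section Norms

variable {n : ℕ}

local notation "𝔼" => EuclideanSpace ℝ (Fin n)

theorem eLpNorm_ennreal_const_mul {X : Type*} [MeasurableSpace X] {μ : Measure X} {c : ℝ≥0∞}
    (hc : c ≠ ∞) (G : X → ℝ≥0∞) {q : ℝ≥0∞} (hq : 1 ≤ q) :
    eLpNorm (fun x => c * G x) q μ = c * eLpNorm G q μ := by
  rcases eq_or_ne q ∞ with rfl | hq'
  · simp only [eLpNorm_exponent_top, eLpNormEssSup, enorm_eq_self]
    exact ENNReal.essSup_const_mul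
  · have hq0 := (zero_lt_one.trans_le hq).ne'
    have hr0 : 0 < q.toReal := ENNReal.toReal_pos hq0 hq'
    rw [eLpNorm_eq_lintegral_rpow_enorm_toReal hq0 hq', eLpNorm_eq_lintegral_rpow_enorm_toReal hq0 hq']
    simp only [enorm_eq_self]
    simp_rw [ENNReal.mul_rpow_of_nonneg _ _ hr0.le]
    rw [lintegral_const_mul' _ _ (ENNReal.rpow_ne_top_of_nonneg hr0.le hc),
      ENNReal.mul_rpow_of_nonneg _ _ (by positivity), ← ENNReal.rpow_mul,
      mul_one_div_cancel hr0.ne', ENNReal.rpow_one]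

theorem stftNorm_eq (φ : 𝓢(𝔼, ℂ)) (s : ℝ) (p : ℝ≥0∞) {q : ℝ≥0∞} (hq : 1 ≤ q) (f : 𝓢'(𝔼, ℂ)) :
    stftNorm φ s p q f = ‖normFactor n‖ₑ * eLpNorm (fun ξ : 𝔼 => ENNReal.ofReal (bracket s ξ) *
      eLpNorm (coeff (fourierD n f) (conjS (fourierS n φ)) ξ) p volume) q volume := by
  rw [stftNorm, ← eLpNorm_ennreal_const_mul enorm_ne_top _ hq]
  congr 1
  ext ξ
  have hb : ENNReal.ofReal (bracket s ξ) = ‖((bracket s ξ : ℝ) : ℂ)‖ₑ := by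
    rw [← ofReal_norm, Complex.norm_real, Real.norm_of_nonneg (bracket_pos s ξ).le]
  rw [hb, ← mul_assoc, ← enorm_mul, ← eLpNorm_const_smul]
  refine eLpNorm_congr_enorm_ae (.of_forall fun x => ?_)
  rw [enorm_mul, enorm_stft, Pi.smul_apply, enorm_smul, enorm_mul]
  exact mul_right_comm _ _ _

theorem Represents.ae_eq {g h : 𝔼 → ℂ} {T : 𝓢'(𝔼, ℂ)} (hg : Represents g T) (hh : Represents h T)
    (hgi : LocallyIntegrable g) (hhi : LocallyIntegrable h) : g =ᵐ[volume] h := by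
  refine ae_eq_of_integral_contDiff_smul_eq hgi hhi fun u hu hc => ?_
  let v : 𝓢(𝔼, ℂ) := (hc.comp_left (g := ((↑) : ℝ → ℂ)) Complex.ofReal_zero).toSchwartzMap
    (Complex.ofRealCLM.contDiff.comp hu)
  have hv : ∀ x, v x = (u x : ℂ) := fun x => rfl
  have h1 := (hg v).symm.trans (hh v)
  simp_rw [hv, mul_comm _ ((u _ : ℝ) : ℂ), ← Complex.real_smul] at h1
  exact h1

/-- A representing function in `L^p` is locally integrable, hence almost everywhere equal to the
continuous one. If `g` is not in `L^p`, both sides are infinite. -/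
theorem lpNorm_eq_eLpNorm {g : 𝔼 → ℂ} (hg : Continuous g) {T : 𝓢'(𝔼, ℂ)} (hT : Represents g T)
    {p : ℝ≥0∞} (hp : 1 ≤ p) : lpNorm p T = eLpNorm g p volume := by
  refine le_antisymm ?_ ?_
  · by_cases h : MemLp g p volume
    · exact iInf₂_le_of_le g h (iInf_le _ hT)
    · have : eLpNorm g p volume = ∞ := by
        by_contra hne
        exact h ⟨hg.aestronglyMeasurable, lt_top_iff_ne_top.2 hne⟩
      rw [this]
      exact le_top
  · refine le_iInf fun h => le_iInf fun hh => le_iInf fun hhT => ?_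
    exact (eLpNorm_congr_ae (hT.ae_eq hhT hg.locallyIntegrable (hh.locallyIntegrable hp))).le

/-! ### The frequency-uniform decomposition -/

variable {ρ : 𝓢(EuclideanSpace ℝ (Fin n), ℝ)}

theorem norm_le_of_ne_zero (hρ : IsDecompositionFunction ρ) {ξ : 𝔼} (h : ρ ξ ≠ 0) :
    ‖ξ‖ ≤ √n := by
  rw [EuclideanSpace.norm_eq]
  refine Real.sqrt_le_sqrt ?_
  calc ∑ i, ‖ξ i‖ ^ 2 ≤ ∑ _i : Fin n, (1 : ℝ) := Finset.sum_le_sum fun i _ => by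
        rw [Real.norm_eq_abs]
        exact pow_le_one₀ (abs_nonneg _) (abs_le.2 (hρ.support_subset _ h i))
    _ = n := by simp

theorem finite_support_translates (hρ : IsDecompositionFunction ρ) (ξ : 𝔼) :
    (Function.support fun k : Fin n → ℤ => ρ (ξ - latticePoint k)).Finite := by
  refine (Set.Finite.pi' (fun i : Fin n => Set.finite_Icc ⌈ξ i - 1⌉ ⌊ξ i + 1⌋)).subset
    fun k hk i => ?_
  have h := hρ.support_subset _ hk i
  simp only [latticePoint, PiLp.sub_apply] at h
  exact ⟨Int.ceil_le.2 (by linarith), Int.le_floor.2 (by linarith)⟩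

theorem sigma_eq_sigma_zero (ρ : 𝓢(𝔼, ℝ)) (k : Fin n → ℤ) (ξ : 𝔼) :
    sigma ρ k ξ = sigma ρ 0 (ξ - latticePoint k) := by
  have hadd : ∀ l : Fin n → ℤ, latticePoint (k + l) = latticePoint k + latticePoint l := fun l => by
    ext i
    simp [latticePoint]
  have h0 : latticePoint (0 : Fin n → ℤ) = 0 := by
    ext i
    simp [latticePoint]
  rw [sigma, sigma, h0, sub_zero, ← (Equiv.addLeft k).tsum_eq]
  simp only [Equiv.coe_addLeft, hadd, sub_sub]

theorem hasSum_sigma (hρ : IsDecompositionFunction ρ) (ξ : 𝔼) :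
    HasSum (fun k : Fin n → ℤ => sigma ρ k ξ) 1 := by
  obtain ⟨m, hm⟩ := hρ.cover ξ
  have hs : Summable fun l : Fin n → ℤ => ρ (ξ - latticePoint l) :=
    summable_of_hasFiniteSupport (finite_support_translates hρ ξ)
  have hpos := hs.tsum_pos (fun l => hρ.nonneg _) m ((hρ.nonneg _).lt_of_ne' hm)
  have h := hs.hasSum.mul_right (∑' l : Fin n → ℤ, ρ (ξ - latticePoint l))⁻¹
  rwa [mul_inv_cancel₀ hpos.ne'] at h

/-- A smooth compactly supported function that equals `1` on the support of `σ₀`. -/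
def cutoff (n : ℕ) : 𝓢(EuclideanSpace ℝ (Fin n), ℂ) :=
  let χ : ContDiffBump (0 : EuclideanSpace ℝ (Fin n)) :=
    ⟨√n + 1, √n + 2, by positivity, by linarith⟩
  (χ.hasCompactSupport.comp_left (g := ((↑) : ℝ → ℂ)) Complex.ofReal_zero).toSchwartzMap
    (Complex.ofRealCLM.contDiff.comp χ.contDiff)

theorem cutoff_eq_one {ξ : 𝔼} (h : ‖ξ‖ ≤ √n) : cutoff n ξ = 1 := by
  let χ : ContDiffBump (0 : 𝔼) := ⟨√n + 1, √n + 2, by positivity, by linarith⟩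
  have h1 : χ ξ = 1 := χ.one_of_mem_closedBall (by
    simp only [mem_closedBall_zero_iff]
    exact h.trans (by linarith))
  have h2 : cutoff n ξ = (χ ξ : ℂ) := rfl
  rw [h2, h1, Complex.ofReal_one]

/-- The function `σ₀`, as a Schwartz function. -/
def sigmaS (ρ : 𝓢(𝔼, ℝ)) : 𝓢(𝔼, ℂ) :=
  -- For a decomposition function `ρ` the cutoff does not change `σ₀`; it only supplies a Schwartz
  -- function to multiply.
  SchwartzMap.smulLeftCLM ℂ (fun ξ => (sigma ρ 0 ξ : ℂ)) (cutoff n)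

theorem sigma_zero_mul_cutoff (hρ : IsDecompositionFunction ρ) (ξ : 𝔼) :
    (sigma ρ 0 ξ : ℂ) * cutoff n ξ = sigma ρ 0 ξ := by
  by_cases h : ρ ξ = 0
  · have h0 : latticePoint (0 : Fin n → ℤ) = 0 := by
      ext i
      simp [latticePoint]
    simp [sigma, h0, h]
  · rw [cutoff_eq_one (norm_le_of_ne_zero hρ h), mul_one]

theorem sigmaS_apply (hρ : IsDecompositionFunction ρ) (ξ : 𝔼) : sigmaS ρ ξ = sigma ρ 0 ξ := by
  rw [sigmaS, SchwartzMap.smulLeftCLM_apply_apply (sigma_hasTemperateGrowth hρ 0), smul_eq_mul,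
    sigma_zero_mul_cutoff hρ]

/-- Testing `□_k f` against `u` pairs `𝓕 f` with `σ_k 𝓕⁻¹ u`; expanding `𝓕⁻¹ u` as an integral of
modulations exhibits the density. -/
theorem represents_box (hρ : IsDecompositionFunction ρ) (k : Fin n → ℤ) (f : 𝓢'(𝔼, ℂ)) :
    Represents (fun x => normFactor n * coeff (fourierD n f) (sigmaS ρ) (latticePoint k) x)
      (box ρ k f) := by
  intro u
  have h1 : box ρ k f u = fourierD n f
      (SchwartzMap.smulLeftCLM ℂ (fun ξ => (sigma ρ k ξ : ℂ)) (fourierInvS n u)) := rfl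
  have h2 : SchwartzMap.smulLeftCLM ℂ (fun ξ => (sigma ρ k ξ : ℂ)) (fourierInvS n u) =
      mulS (translate (latticePoint k) (sigmaS ρ)) (fourierInvS n u) := by
    ext ξ
    rw [SchwartzMap.smulLeftCLM_apply_apply (sigma_hasTemperateGrowth hρ k), mulS_apply,
      translate_apply, sigmaS_apply hρ, ← sigma_eq_sigma_zero, smul_eq_mul]
  rw [h1, h2]
  refine (integrable_and_apply_mulS_fourierInvS (fourierD n f) _ u).2.trans ?_
  rw [← integral_const_mul]
  refine integral_congr_ae (.of_forall fun x => ?_)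
  simp only [coeff]
  ring

theorem lpNorm_box (hρ : IsDecompositionFunction ρ) (k : Fin n → ℤ) (f : 𝓢'(𝔼, ℂ)) {p : ℝ≥0∞}
    (hp : 1 ≤ p) : lpNorm p (box ρ k f) = ‖normFactor n‖ₑ *
      eLpNorm (coeff (fourierD n f) (sigmaS ρ) (latticePoint k)) p volume := by
  have hc : Continuous (coeff (fourierD n f) (sigmaS ρ) (latticePoint k)) := by
    have h := (continuous_coeff (fourierD n f) (sigmaS ρ)).comp
      (f := fun t : 𝔼 => (latticePoint k, t)) (by fun_prop)
    exact h
  rw [lpNorm_eq_eLpNorm (continuous_const.mul hc) (represents_box hρ k f) hp,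
    ← eLpNorm_const_smul]
  rfl

/-- Counting measure unifies the sum and the supremum, which gives this norm the same form as the
one in `stftNorm_eq`. -/
theorem decompositionNorm_eq (hρ : IsDecompositionFunction ρ) (s : ℝ) {p q : ℝ≥0∞} (hp : 1 ≤ p)
    (hq : 1 ≤ q) (f : 𝓢'(𝔼, ℂ)) :
    decompositionNorm ρ s p q f = ‖normFactor n‖ₑ *
      eLpNorm (fun k : Fin n → ℤ => ENNReal.ofReal (bracket s (latticePoint k)) *
        eLpNorm (coeff (fourierD n f) (sigmaS ρ) (latticePoint k)) p volume) q Measure.count := by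
  rw [← eLpNorm_ennreal_const_mul enorm_ne_top _ hq]
  simp_rw [mul_left_comm ‖normFactor n‖ₑ, ← lpNorm_box hρ _ f hp]
  rw [decompositionNorm]
  split_ifs with h
  · rw [h, eLpNorm_exponent_top, eLpNormEssSup_count]
    simp only [enorm_eq_self]
  · rw [eLpNorm_eq_lintegral_rpow_enorm_toReal (zero_lt_one.trans_le hq).ne' h, lintegral_count]
    simp only [enorm_eq_self]

/-! ### The two resolutions of the identity -/

theorem integral_count_cutoff_mul_sigmaS (hρ : IsDecompositionFunction ρ) (η : 𝔼) :
    ∫ k : Fin n → ℤ, cutoff n (η - latticePoint k) * sigmaS ρ (η - latticePoint k)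
      ∂Measure.count = 1 := by
  have h1 : ∀ k : Fin n → ℤ, cutoff n (η - latticePoint k) * sigmaS ρ (η - latticePoint k) =
      (sigma ρ k η : ℂ) := fun k => by
    rw [sigmaS_apply hρ, mul_comm, sigma_zero_mul_cutoff hρ, ← sigma_eq_sigma_zero]
  have hs : HasSum (fun k : Fin n → ℤ => (sigma ρ k η : ℂ)) 1 := by
    simpa using Complex.ofRealCLM.hasSum (hasSum_sigma hρ η)
  simp_rw [h1]
  rw [integral_countable (integrable_count_iff.2 hs.summable.norm)]
  simpa using hs.tsum_eq

theorem integral_mul_conjS (v : 𝓢(𝔼, ℂ)) (η : 𝔼) :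
    ∫ ξ : 𝔼, v (η - id ξ) * conjS v (η - id ξ) = ((∫ ξ : 𝔼, ‖v ξ‖ ^ 2 : ℝ) : ℂ) := by
  simp only [id]
  rw [integral_sub_left_eq_self (fun ξ => v ξ * conjS v ξ) volume η, ← integral_complex_ofReal]
  refine integral_congr_ae (.of_forall fun ξ => ?_)
  simp only [conjS_apply, Complex.mul_conj, Complex.normSq_eq_norm_sq]

theorem integral_norm_sq_ne_zero {v : 𝓢(𝔼, ℂ)} (hv : v ≠ 0) : ∫ ξ : 𝔼, ‖v ξ‖ ^ 2 ≠ 0 := by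
  intro h
  have hi : Integrable fun ξ : 𝔼 => ‖v ξ‖ ^ 2 :=
    (memLp_two_iff_integrable_sq_norm v.continuous.aestronglyMeasurable).1 (v.memLp 2)
  rw [integral_eq_zero_iff_of_nonneg (fun ξ => by positivity) hi] at h
  have hc : Continuous fun ξ : 𝔼 => ‖v ξ‖ ^ 2 := by
    have := v.continuous
    fun_prop
  have h2 := (hc.ae_eq_iff_eq volume continuous_const).1 h
  refine hv (SchwartzMap.ext fun ξ => ?_)
  have : ‖v ξ‖ ^ 2 = 0 := congr_fun h2 ξ
  simpa using this

end Norms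

end ModulationSpace

end

/-! ### The equivalence of the two norms -/

theorem proposition1p12 (n : ℕ)
    (φ : 𝓢(EuclideanSpace ℝ (Fin n), ℂ)) (hφ : φ ≠ 0)
    (ρ : 𝓢(EuclideanSpace ℝ (Fin n), ℝ)) (hρ : ModulationSpace.IsDecompositionFunction ρ)
    (s : ℝ) :
    ∃ C₁ C₂ : ℝ≥0, 0 < C₁ ∧ 0 < C₂ ∧
      ∀ p q : ℝ≥0∞, 1 ≤ p → 1 ≤ q →
        ∀ f : 𝓢'(EuclideanSpace ℝ (Fin n), ℂ),
          C₁ * ModulationSpace.stftNorm φ s p q f ≤ ModulationSpace.decompositionNorm ρ s p q f ∧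
          ModulationSpace.decompositionNorm ρ s p q f ≤ C₂ * ModulationSpace.stftNorm φ s p q f := by
  open ModulationSpace in
  have hv : fourierS n φ ≠ 0 := fun h => hφ (by rw [← fourierInvS_fourierS φ, h, map_zero])
  -- The lattice family controls the continuous one through `∑_k σ_k = 1`; the reverse control uses
  -- `∫ |𝓕 φ|² ≠ 0`.
  obtain ⟨C, hC⟩ := exists_eLpNorm_eLpNorm_coeff_le hasBoundedDensity_id
    hasBoundedDensity_latticePoint (conjS (fourierS n φ)) (cutoff n) (sigmaS ρ) one_ne_zero
    (integral_count_cutoff_mul_sigmaS hρ) s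
  obtain ⟨C', hC'⟩ := exists_eLpNorm_eLpNorm_coeff_le hasBoundedDensity_latticePoint
    hasBoundedDensity_id (sigmaS ρ) (fourierS n φ) (conjS (fourierS n φ))
    (Complex.ofReal_ne_zero.2 (integral_norm_sq_ne_zero hv)) (integral_mul_conjS _) s
  -- Adding `1` keeps the constants positive, since `C` and `C'` may vanish.
  refine ⟨(C + 1)⁻¹, C' + 1, by positivity, by positivity, fun p q hp hq f => ?_⟩
  have h1 := hC (fourierD n f) p q hp hq
  have h2 := hC' (fourierD n f) p q hp hq
  simp only [id] at h1 h2
  rw [stftNorm_eq φ s p hq f, decompositionNorm_eq hρ s hp hq f]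
  constructor
  · rw [ENNReal.coe_inv (by positivity), mul_left_comm]
    refine mul_le_mul_right ?_ _
    rw [ENNReal.inv_mul_le_iff (by simp) (by simp)]
    refine h1.trans (mul_le_mul_left ?_ _)
    exact_mod_cast le_self_add
  · rw [mul_left_comm]
    refine mul_le_mul_right (h2.trans (mul_le_mul_left ?_ _)) _
    exact_mod_cast le_self_add
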